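/- Let $n\in\mathbb N$ and let $\mathcal E_n$ be the $\mathbb R$-algebra of germs at $0$ of real $C^\infty$ functions on $\mathbb R^n$. For $f\in\mathcal E_n$ let $J(f)\subset\mathcal E_n$ be the ideal generated by $\partial f/\partial x_1,\dots,\partial f/\partial x_n$, and let $\mu(f)=\dim_{\mathbb R}\mathcal E_n/J(f)\in\mathbb N\cup\{+\infty\}$ be the real Milnor number of $f$; $f$ has an algebraically isolated singularity at $0$ if $\mu(f)<+\infty$. The initial part $\mathrm{in}(f)$ of $f$ at $0$ is the function $f_\alpha$, positively homogeneous of some degree $\alpha\ge 0$, such that $f_\alpha(x)/\|x\|^\alpha$ does not tend to $0$ and $(f(x)-f_\alpha(x))/\|x\|^\alpha\to 0$ as $x\to 0$ (if it exists, it is the nonzero homogeneous part of lowest degree of the Taylor series of $f$ at $0$). **Theorem.** Let $f,g\colon(\mathbb R^n,0)\to(\mathbb R,0)$ be germs of $C^\infty$ functions which have initial parts $\mathrm{in}(f)$ and $\mathrm{in}(g)$ at $0$, and suppose that $\mathrm{in}(f)$ and $\mathrm{in}(g)$ have algebraically isolated singularities at $0$. Suppose that $f$ and $g$ are $\mathcal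 R$-asymptotically Lipschitz equivalent at $0$, that is, there are open neighbourhoods $U,V$ of $0$ in $\mathbb R^n$, a bijection $\varphi\colon U\to V$ with $\varphi(0)=0$ and a constant $c>0$ with $\frac1c\|x-y\|\le\|\varphi(x)-\varphi(y)\|\le c\|x-y\|$ for all $x,y\in U$, and constants $c_1,c_2>0$ such that $c_2|f(x)|\le|g(\varphi(x))|\le c_1|f(x)|$ for all $x$ in some neighbourhood of $0$. Then $\mu(f)=\mu(g)$. -/

import Mathlib

open Filter Topology Asymptotics
open scoped ContDiff

/-- `ℝⁿ` with its Euclidean norm. -/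
abbrev RSpace (n : ℕ) : Type := EuclideanSpace ℝ (Fin n)

/-- `f` represents the germ at `0` of a `C^∞` function: it is `C^∞` on a whole neighbourhood of `0`.
(This is stronger than `ContDiffAt ℝ ∞ f 0`, which lets the neighbourhood shrink with the order
of differentiability.) -/
def IsSmoothGerm {n : ℕ} (f : RSpace n → ℝ) : Prop :=
  ∀ᶠ x in 𝓝 (0 : RSpace n), ContDiffAt ℝ ∞ f x

/-- The partial derivative `∂f/∂xᵢ`. -/
noncomputable def partialD {n : ℕ} (i : Fin n) (f : RSpace n → ℝ) : RSpace n → ℝ :=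
  fun x => fderiv ℝ f x (EuclideanSpace.single i (1 : ℝ))

theorem IsSmoothGerm.partialD {n : ℕ} {f : RSpace n → ℝ} (hf : IsSmoothGerm f) (i : Fin n) :
    IsSmoothGerm (partialD i f) := by
  filter_upwards [hf] with x hx
  have h : ContDiffAt ℝ ∞ (fderiv ℝ f) x := hx.fderiv_right (by simp)
  exact h.clm_apply contDiffAt_const

/-- The pointwise `ℝ`-algebra structure on germs at `0` of arbitrary functions `ℝⁿ → ℝ`. -/
noncomputable instance germAlgebra (n : ℕ) : Algebra ℝ (Germ (𝓝 (0 : RSpace n)) ℝ) :=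
  Algebra.ofModule
    (fun r x y => by
      induction x using Germ.inductionOn with | _ f
      induction y using Germ.inductionOn with | _ g
      exact congrArg Germ.ofFun (smul_mul_assoc r f g))
    (fun r x y => by
      induction x using Germ.inductionOn with | _ f
      induction y using Germ.inductionOn with | _ g
      exact congrArg Germ.ofFun (mul_smul_comm r f g))

/-- The `ℝ`-algebra `𝓔ₙ` of germs at `0` of `C^∞` functions `ℝⁿ → ℝ`. -/
noncomputable def smoothGerms (n : ℕ) : Subalgebra ℝ (Germ (𝓝 (0 : RSpace n)) ℝ) where
  carrier := {p | ∃ f : RSpace n → ℝ, IsSmoothGerm f ∧ p = (f : Germ (𝓝 (0 : RSpace n)) ℝ)}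
  mul_mem' := by
    rintro _ _ ⟨f, hf, rfl⟩ ⟨g, hg, rfl⟩
    refine ⟨f * g, ?_, rfl⟩
    filter_upwards [hf, hg] with x h₁ h₂
    exact h₁.mul h₂
  add_mem' := by
    rintro _ _ ⟨f, hf, rfl⟩ ⟨g, hg, rfl⟩
    refine ⟨f + g, ?_, rfl⟩
    filter_upwards [hf, hg] with x h₁ h₂
    exact h₁.add h₂
  algebraMap_mem' := by
    intro r
    refine ⟨fun _ => r, Eventually.of_forall fun _ => contDiffAt_const, ?_⟩
    rw [Algebra.algebraMap_eq_smul_one]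
    refine congrArg Germ.ofFun (funext fun x => ?_)
    simp

/-- The element of `𝓔ₙ` represented by `f`. -/
noncomputable def IsSmoothGerm.germ {n : ℕ} {f : RSpace n → ℝ} (hf : IsSmoothGerm f) :
    smoothGerms n :=
  ⟨(f : Germ (𝓝 (0 : RSpace n)) ℝ), f, hf, rfl⟩

/-- The Jacobian ideal `J(f) ⊆ 𝓔ₙ`, generated by the partial derivatives of `f`. -/
noncomputable def jacobianIdeal {n : ℕ} (f : RSpace n → ℝ) (hf : IsSmoothGerm f) :
    Ideal (smoothGerms n) :=
  Ideal.span (Set.range fun i : Fin n => (hf.partialD i).germ)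

/-- The real Milnor number `μ(f) = dim_ℝ 𝓔ₙ / J(f)`, with value `⊤` if the dimension is infinite. -/
noncomputable def milnorNumber {n : ℕ} (f : RSpace n → ℝ) (hf : IsSmoothGerm f) : ℕ∞ :=
  Cardinal.toENat (Module.rank ℝ (smoothGerms n ⧸ jacobianIdeal f hf))

/-- `f ∈ 𝓔ₙ` has an algebraically isolated singularity at `0`: its Milnor number is finite. -/
def AlgIsolatedSing {n : ℕ} (f : RSpace n → ℝ) : Prop :=
  ∃ hf : IsSmoothGerm f, milnorNumber f hf < ⊤

/-- `h` is the initial part `in(f)` of `f` at `0`: for some `α ≥ 0`, `h` is (positively) homogeneous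
of degree `α`, `h(x) / ‖x‖^α` does not tend to `0`, and `f(x) - h(x) = o(‖x‖^α)` as `x → 0`.
For a smooth `f` there is at most one such `h`, namely the nonzero homogeneous part of lowest degree
of its Taylor series. -/
def IsInitialPart {n : ℕ} (f h : RSpace n → ℝ) : Prop :=
  ∃ α : ℝ, 0 ≤ α ∧
    (∀ t : ℝ, 0 < t → ∀ x, h (t • x) = t ^ α * h x) ∧
    ¬ (h =o[𝓝 0] fun x => ‖x‖ ^ α) ∧
    (fun x => f x - h x) =o[𝓝 0] fun x => ‖x‖ ^ α

/-- `φ` restricts to a lipeomorphism (bi-Lipschitz bijection) from `U` onto `V`. -/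
def IsLipeomorphism {n : ℕ} (φ : RSpace n → RSpace n) (U V : Set (RSpace n)) : Prop :=
  Set.BijOn φ U V ∧ ∃ c : ℝ, 0 < c ∧ ∀ x ∈ U, ∀ y ∈ U,
    1 / c * ‖x - y‖ ≤ ‖φ x - φ y‖ ∧ ‖φ x - φ y‖ ≤ c * ‖x - y‖

/-- `F ∼₀ G`: asymptotic equivalence at `0`. -/
def AsympEquivAtZero {n : ℕ} (F G : RSpace n → ℝ) : Prop :=
  ∃ c₁ c₂ : ℝ, 0 < c₁ ∧ 0 < c₂ ∧
    ∀ᶠ x in 𝓝 (0 : RSpace n), c₂ * ‖F x‖ ≤ ‖G x‖ ∧ ‖G x‖ ≤ c₁ * ‖F x‖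

/-- `f` and `g` are `𝓡`-asymptotically Lipschitz equivalent at `0`: `f ∼₀ g ∘ φ` for a germ of
lipeomorphism `φ : (ℝⁿ, 0) → (ℝⁿ, 0)`. -/
def RAsympLipEquiv {n : ℕ} (f g : RSpace n → ℝ) : Prop :=
  ∃ (φ : RSpace n → RSpace n) (U V : Set (RSpace n)),
    IsOpen U ∧ IsOpen V ∧ (0 : RSpace n) ∈ U ∧ φ 0 = 0 ∧ IsLipeomorphism φ U V ∧
      AsympEquivAtZero f (g ∘ φ)

/-! Both Milnor numbers are determined by `n` and the degree of the initial part, so it suffices to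
compare degrees. The degree is a Lipschitz invariant: `φ` changes norms by bounded factors only, so
decay of `g` of some order is inherited by `f`, and conversely (`le_of_rAsympLipEquiv`). A smooth
positively homogeneous function is a polynomial form (`exists_eq_eval_of_homogeneous`), so the
initial part is a form `Q` of degree `d + 1`, and each `∂f/∂xᵢ` is `∂Q/∂xᵢ` plus terms of order at
least `d + 1`.

What remains is algebra (`rank_quotient_span_eq`): if `n` elements `F i` have initial forms `p i` of
one degree `m` that generate an ideal of finite codimension, then the codimension of `(F i)` depends
only on `m` and `n`. By Nakayama `(F i)` contains a power of the maximal ideal, so the quotient is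
that of the polynomial ring by `(G i) + 𝔪 ^ N`, with Taylor polynomials `G i` and `N` large.

The polynomial ring has depth `n` along `𝔪`, so prime avoidance over an infinite field yields `n`
independent combinations of the `p i` that form a regular sequence
(`exists_linearIndependent_combinations_regular`). Regularity passes to the same combinations of the
`G i` modulo `𝔪 ^ N`, at the cost of `m` orders (`mem_span_sup_pow_of_mul_deformation_mem`). Hence
adjoining one more generator subtracts from the dimension at level `N` the dimension at level `N -
m`. This recursion, `truncatedDim`, no longer sees the `G i`, and its value need not be computed. -/

theorem Ideal.mul_mem_pow_of_le {R : Type*} [CommRing R] {I : Ideal R} {a b : R} {i j k : ℕ}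
    (ha : a ∈ I ^ i) (hb : b ∈ I ^ j) (hk : k ≤ i + j) : a * b ∈ I ^ k := by
  refine Ideal.pow_le_pow_right hk ?_
  rw [pow_add]
  exact Ideal.mul_mem_mul ha hb

theorem Ideal.span_image_Iio_succ {R : Type*} [CommRing R] (G : ℕ → R) (j : ℕ) :
    Ideal.span (G '' Set.Iio (j + 1)) = Ideal.span (G '' Set.Iio j) ⊔ Ideal.span {G j} := by
  rw [← Ideal.span_union, ← Set.image_singleton, ← Set.image_union]
  congr 2
  ext i
  simp

namespace MvPolynomial

/-! ### Truncation by degree and ideals generated by forms of equal degree -/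

section LowDegree

variable {σ R : Type*} [CommRing R]

/-- The sum of the homogeneous components of `u` of degree less than `d`. -/
noncomputable def lowDegreePart (d : ℕ) : MvPolynomial σ R →ₗ[R] MvPolynomial σ R :=
  ∑ i ∈ Finset.range d, homogeneousComponent i

theorem coeff_lowDegreePart (d : ℕ) (u : MvPolynomial σ R) (x : σ →₀ ℕ) :
    coeff x (lowDegreePart d u) = if x.degree < d then coeff x u else 0 := by
  classical
  simp [lowDegreePart, coeff_sum, coeff_homogeneousComponent]

theorem sub_lowDegreePart_mem (d : ℕ) (u : MvPolynomial σ R) :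
    u - lowDegreePart d u ∈ idealOfVars σ R ^ d := by
  rw [mem_pow_idealOfVars_iff']
  intro x hx
  simp [coeff_lowDegreePart, hx]

theorem lowDegreePart_eq_zero {d : ℕ} {u : MvPolynomial σ R} (hu : u ∈ idealOfVars σ R ^ d) :
    lowDegreePart d u = 0 := by
  rw [mem_pow_idealOfVars_iff'] at hu
  ext x
  rw [coeff_lowDegreePart]
  split_ifs with h
  · simpa using hu x h
  · simp

/-- Multiplication by a form of degree `m` shifts every homogeneous component by `m`. This is why
all generators below are required to have the same degree: truncation then acts on the coefficients
alone. -/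
theorem lowDegreePart_mul {d m : ℕ} (a : MvPolynomial σ R) {p : MvPolynomial σ R}
    (hp : p.IsHomogeneous m) :
    lowDegreePart (d + m) (a * p) = lowDegreePart d a * p := by
  let _ : GradedAlgebra (homogeneousSubmodule σ R) := gradedAlgebra
  have h1 : ∀ i u, homogeneousComponent i u =
      (DirectSum.decompose (homogeneousSubmodule σ R) u i : MvPolynomial σ R) := fun i u =>
    (decomposition.decompose'_apply u i).symm
  have hp' : p ∈ homogeneousSubmodule σ R m := hp
  simp only [lowDegreePart, LinearMap.sum_apply]
  rw [add_comm d m, Finset.sum_range_add, Finset.sum_eq_zero, zero_add, Finset.sum_mul]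
  · refine Finset.sum_congr rfl fun i _ => ?_
    rw [h1, h1, add_comm, DirectSum.coe_decompose_mul_add_of_right_mem _ hp']
  · intro i hi
    rw [h1, DirectSum.coe_decompose_mul_of_right_mem_of_not_le _ hp']
    simpa using hi

theorem lowDegreePart_mem_span {d m : ℕ} {S : Set (MvPolynomial σ R)}
    (hS : ∀ p ∈ S, p.IsHomogeneous m) {v : MvPolynomial σ R} (hv : v ∈ Ideal.span S) :
    lowDegreePart (d + m) v ∈ Ideal.span S := by
  induction hv using Submodule.closure_induction with
  | zero => simp
  | add x y _ _ hx hy => simpa using add_mem hx hy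
  | smul_mem a p hp =>
    rw [smul_eq_mul, lowDegreePart_mul a (hS p hp)]
    exact Ideal.mul_mem_left _ _ (Ideal.subset_span hp)

theorem sub_lowDegreePart_mem_mul_span {d m : ℕ} {S : Set (MvPolynomial σ R)}
    (hS : ∀ p ∈ S, p.IsHomogeneous m) {v : MvPolynomial σ R} (hv : v ∈ Ideal.span S) :
    v - lowDegreePart (d + m) v ∈ idealOfVars σ R ^ d * Ideal.span S := by
  induction hv using Submodule.closure_induction with
  | zero => simp
  | add x y _ _ hx hy =>
    rw [map_add, add_sub_add_comm]
    exact add_mem hx hy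
  | smul_mem a p hp =>
    rw [smul_eq_mul, lowDegreePart_mul a (hS p hp), ← sub_mul]
    exact Ideal.mul_mem_mul (sub_lowDegreePart_mem d a) (Ideal.subset_span hp)

/-- Elements of order `s` of an ideal generated by forms of degree `m` are combinations of these
forms with coefficients of order `s - m`. -/
theorem span_inf_pow_le_mul_span {m : ℕ} (s : ℕ) {S : Set (MvPolynomial σ R)}
    (hS : ∀ p ∈ S, p.IsHomogeneous m) :
    Ideal.span S ⊓ idealOfVars σ R ^ s ≤ idealOfVars σ R ^ (s - m) * Ideal.span S := by
  rintro v ⟨hv, hvs⟩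
  rcases le_total s m with h | h
  · simpa [Nat.sub_eq_zero_of_le h] using hv
  · have := sub_lowDegreePart_mem_mul_span (d := s - m) hS hv
    rwa [Nat.sub_add_cancel h, lowDegreePart_eq_zero hvs, sub_zero] at this

/-- If multiplication by a form `p` of degree `m` is injective modulo an ideal generated by forms
of degree `m`, it remains so modulo powers of the ideal of variables. -/
theorem mem_span_sup_pow_of_mul_mem {m s : ℕ} {S : Set (MvPolynomial σ R)}
    (hS : ∀ p ∈ S, p.IsHomogeneous m) {p : MvPolynomial σ R} (hp : p.IsHomogeneous m)
    (hreg : ∀ u, u * p ∈ Ideal.span S → u ∈ Ideal.span S) {u : MvPolynomial σ R}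
    (hu : u * p ∈ Ideal.span S ⊔ idealOfVars σ R ^ (s + m)) :
    u ∈ Ideal.span S ⊔ idealOfVars σ R ^ s := by
  obtain ⟨v, hv, w, hw, hvw⟩ := Submodule.mem_sup.mp hu
  have h := congrArg (lowDegreePart (s + m)) hvw
  rw [map_add, lowDegreePart_eq_zero hw, add_zero, lowDegreePart_mul u hp] at h
  have h' := hreg _ (h ▸ lowDegreePart_mem_span hS hv)
  exact Submodule.mem_sup.mpr ⟨_, h', _, sub_lowDegreePart_mem s u, by ring⟩

/-- A form lying in an ideal generated by forms modulo high order terms lies in that ideal. -/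
theorem mem_span_of_mem_sup_pow {m d : ℕ} {S : Set (MvPolynomial σ R)}
    (hS : ∀ p ∈ S, p.IsHomogeneous m) {u : MvPolynomial σ R} (hu : u.IsHomogeneous d)
    (h : u ∈ Ideal.span S ⊔ idealOfVars σ R ^ (d + 1 + m)) : u ∈ Ideal.span S := by
  obtain ⟨v, hv, w, hw, hvw⟩ := Submodule.mem_sup.mp h
  have hlow : lowDegreePart (d + 1 + m) u = u := by
    ext x
    rw [coeff_lowDegreePart]
    split_ifs with hx
    · rfl
    · by_contra hne
      have : x.degree = d := by
        rw [Finsupp.degree_eq_weight_one]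
        exact hu (Ne.symm hne)
      omega
  rw [← hlow, ← hvw, map_add, lowDegreePart_eq_zero hw, add_zero]
  exact lowDegreePart_mem_span hS hv

theorem IsHomogeneous.mem_pow_idealOfVars {d : ℕ} {u : MvPolynomial σ R} (hu : u.IsHomogeneous d) :
    u ∈ idealOfVars σ R ^ d := by
  rw [mem_pow_idealOfVars_iff']
  intro x hx
  by_contra hne
  have : x.degree = d := by
    rw [Finsupp.degree_eq_weight_one]
    exact hu hne
  omega

instance finite_quotient_pow_idealOfVars [Finite σ] (N : ℕ) :
    Module.Finite R (MvPolynomial σ R ⧸ idealOfVars σ R ^ N) := by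
  have hfin : {x : σ →₀ ℕ | x.degree < N}.Finite := Finsupp.finite_of_degree_lt N
  refine ⟨⟨(hfin.image fun x => Ideal.Quotient.mk _ (monomial x (1 : R))).toFinset, ?_⟩⟩
  rw [Set.Finite.coe_toFinset, eq_top_iff]
  rintro v -
  obtain ⟨u, rfl⟩ := Ideal.Quotient.mk_surjective v
  have h : Ideal.Quotient.mk (idealOfVars σ R ^ N) u =
      Ideal.Quotient.mkₐ R (idealOfVars σ R ^ N) (lowDegreePart N u) :=
    Ideal.Quotient.eq.mpr (sub_lowDegreePart_mem N u)
  rw [h, (lowDegreePart N u).as_sum, map_sum]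
  refine Submodule.sum_mem _ fun x hx => ?_
  have hxN : x.degree < N := by
    by_contra hcon
    rw [mem_support_iff, coeff_lowDegreePart, if_neg hcon] at hx
    exact hx rfl
  rw [← mul_one (coeff x _), ← smul_eq_mul, ← smul_monomial, map_smul]
  exact Submodule.smul_mem _ _ (Submodule.subset_span ⟨x, hxN, rfl⟩)

end LowDegree

/-! ### Perturbing a regular sequence of forms by higher order terms -/

section Deformation

variable {σ R : Type*} [CommRing R] {m : ℕ} {p G : ℕ → MvPolynomial σ R}

local notation "𝔪" => idealOfVars σ R

theorem span_le_span_sup_pow (hG : ∀ i, G i - p i ∈ 𝔪 ^ (m + 1)) (j : ℕ) :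
    Ideal.span (p '' Set.Iio j) ≤ Ideal.span (G '' Set.Iio j) ⊔ 𝔪 ^ (m + 1) := by
  rw [Ideal.span_le]
  rintro _ ⟨i, hi, rfl⟩
  exact Submodule.mem_sup.mpr ⟨G i, Ideal.subset_span ⟨i, hi, rfl⟩, -(G i - p i),
    neg_mem (hG i), by ring⟩

/-- An element of order `s` in `(p i)` has coefficients of order `s - m`, so replacing each `p i` by
`G i` costs only terms of order `s + 1`. -/
theorem pow_inf_sup_le_span_sup_pow (hp : ∀ i, (p i).IsHomogeneous m)
    (hG : ∀ i, G i - p i ∈ 𝔪 ^ (m + 1)) (j s : ℕ) :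
    𝔪 ^ s ⊓ (Ideal.span (p '' Set.Iio j) ⊔ 𝔪 ^ (s + 1)) ≤
      Ideal.span (G '' Set.Iio j) ⊔ 𝔪 ^ (s + 1) := by
  rintro u ⟨hu, hu'⟩
  obtain ⟨v, hv, w, hw, rfl⟩ := Submodule.mem_sup.mp hu'
  refine add_mem ?_ (Ideal.mem_sup_right hw)
  have hvs : v ∈ 𝔪 ^ s := by
    have := sub_mem hu (Ideal.pow_le_pow_right (Nat.le_succ s) hw)
    rwa [add_sub_cancel_right] at this
  have hS : ∀ q ∈ p '' Set.Iio j, q.IsHomogeneous m := by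
    rintro _ ⟨i, -, rfl⟩
    exact hp i
  have h1 := span_inf_pow_le_mul_span s hS ⟨hv, hvs⟩
  have h2 := Ideal.mul_mono_right (I := 𝔪 ^ (s - m)) (span_le_span_sup_pow hG j) h1
  rw [Ideal.mul_sup, ← pow_add] at h2
  have h3 : 𝔪 ^ (s - m) * Ideal.span (G '' Set.Iio j) ⊔ 𝔪 ^ (s - m + (m + 1)) ≤
      Ideal.span (G '' Set.Iio j) ⊔ 𝔪 ^ (s + 1) :=
    sup_le_sup Ideal.mul_le_right (Ideal.pow_le_pow_right (by omega))
  exact h3 h2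

/-- If the initial forms of elements of `(G 0, …, G (j - 1))` lie in `(p 0, …, p (j - 1))` and `p j`
is regular modulo this ideal, then multiplication by `G j` raises orders modulo
`(G 0, …, G (j - 1))` by exactly `m`. -/
theorem mem_span_sup_pow_of_mul_mem_of_initial (hp : ∀ i, (p i).IsHomogeneous m)
    (hG : ∀ i, G i - p i ∈ 𝔪 ^ (m + 1)) {j : ℕ}
    (hreg : ∀ u, u * p j ∈ Ideal.span (p '' Set.Iio j) → u ∈ Ideal.span (p '' Set.Iio j))
    (hin : ∀ s, 𝔪 ^ s ⊓ (Ideal.span (G '' Set.Iio j) ⊔ 𝔪 ^ (s + 1)) ≤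
      Ideal.span (p '' Set.Iio j) ⊔ 𝔪 ^ (s + 1))
    {N : ℕ} {u : MvPolynomial σ R} (hu : u * G j ∈ Ideal.span (G '' Set.Iio j) ⊔ 𝔪 ^ N) :
    u ∈ Ideal.span (G '' Set.Iio j) ⊔ 𝔪 ^ (N - m) := by
  have hS : ∀ q ∈ p '' Set.Iio j, q.IsHomogeneous m := by
    rintro _ ⟨i, -, rfl⟩
    exact hp i
  have hGm : G j ∈ 𝔪 ^ m := by
    have := add_mem (Ideal.pow_le_pow_right (Nat.le_succ m) (hG j)) (hp j).mem_pow_idealOfVars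
    rwa [sub_add_cancel] at this
  suffices H : ∀ s ≤ N - m, u ∈ Ideal.span (G '' Set.Iio j) ⊔ 𝔪 ^ s from H _ le_rfl
  intro s
  induction s with
  | zero => simp
  | succ s ih =>
    intro hs
    -- Modulo the earlier `G i`, `u` is some `w` of order `s`. As `s + m < N`, `hin` places `w * G
    -- j` in `(p i)` up to order `s + m + 1`; there `G j` may be exchanged for `p j`, whose
    -- regularity gains one order for `w`.
    obtain ⟨v, hv, w, hw, rfl⟩ := Submodule.mem_sup.mp (ih (by omega))
    refine add_mem (Ideal.mem_sup_left hv) (pow_inf_sup_le_span_sup_pow hp hG j s ⟨hw, ?_⟩)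
    have hwG : w * G j ∈ Ideal.span (G '' Set.Iio j) ⊔ 𝔪 ^ N := by
      have := sub_mem hu (Ideal.mem_sup_left (T := 𝔪 ^ N) (Ideal.mul_mem_right (G j) _ hv))
      rwa [add_mul, add_sub_cancel_left] at this
    have h1 : w * G j ∈ 𝔪 ^ (s + m) := Ideal.mul_mem_pow_of_le hw hGm le_rfl
    have hle : Ideal.span (G '' Set.Iio j) ⊔ 𝔪 ^ N ≤
        Ideal.span (G '' Set.Iio j) ⊔ 𝔪 ^ (s + m + 1) :=
      sup_le_sup_left (Ideal.pow_le_pow_right (by omega)) _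
    have h2 := hin (s + m) ⟨h1, hle hwG⟩
    have h3 : w * (G j - p j) ∈ 𝔪 ^ (s + m + 1) := Ideal.mul_mem_pow_of_le hw (hG j) (by omega)
    have h4 : w * p j ∈ Ideal.span (p '' Set.Iio j) ⊔ 𝔪 ^ (s + 1 + m) := by
      have := sub_mem h2 (Ideal.mem_sup_right h3)
      rw [← mul_sub, sub_sub_cancel] at this
      rwa [add_right_comm]
    exact mem_span_sup_pow_of_mul_mem hS (hp j) hreg h4

/-- The initial forms of elements of `(G 0, …, G (j - 1))` lie in `(p 0, …, p (j - 1))`. -/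
theorem pow_inf_span_sup_pow_le (hp : ∀ i, (p i).IsHomogeneous m)
    (hG : ∀ i, G i - p i ∈ 𝔪 ^ (m + 1)) {j : ℕ}
    (hreg : ∀ i < j, ∀ u, u * p i ∈ Ideal.span (p '' Set.Iio i) → u ∈ Ideal.span (p '' Set.Iio i))
    (s : ℕ) :
    𝔪 ^ s ⊓ (Ideal.span (G '' Set.Iio j) ⊔ 𝔪 ^ (s + 1)) ≤
      Ideal.span (p '' Set.Iio j) ⊔ 𝔪 ^ (s + 1) := by
  induction j generalizing s with
  | zero => simp
  | succ j ih =>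
    have hin := ih fun i hi => hreg i (by omega)
    rintro v ⟨hv, hv'⟩
    rw [Ideal.span_image_Iio_succ, sup_assoc] at hv'
    obtain ⟨a, ha, b, hb, hab⟩ := Submodule.mem_sup.mp hv'
    obtain ⟨c, hc, d, hd, rfl⟩ := Submodule.mem_sup.mp hb
    obtain ⟨b, rfl⟩ := Ideal.mem_span_singleton'.mp hc
    have hbG : b * G j ∈ Ideal.span (G '' Set.Iio j) ⊔ 𝔪 ^ s := by
      have heq : b * G j = -a + (v - d) := by rw [← hab]; ring
      rw [heq]
      exact add_mem (Ideal.mem_sup_left (neg_mem ha))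
        (Ideal.mem_sup_right (sub_mem hv (Ideal.pow_le_pow_right (Nat.le_succ s) hd)))
    have hbI := mem_span_sup_pow_of_mul_mem_of_initial hp hG (hreg j (Nat.lt_succ_self j)) hin hbG
    -- The coefficient of `G j` matters only modulo the earlier `G i`, so it may be taken to be
    -- `b'`, of order `s - m`. Then `v - b' * p j` has order `s` and lies in the smaller ideal up to
    -- order `s + 1`, where `hin` applies.
    obtain ⟨e, he, b', hb', rfl⟩ := Submodule.mem_sup.mp hbI
    have hGp : b' * (G j - p j) ∈ 𝔪 ^ (s + 1) :=
      Ideal.mul_mem_pow_of_le (i := s - m) hb' (hG j) (by omega)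
    have hpb : b' * p j ∈ 𝔪 ^ s :=
      Ideal.mul_mem_pow_of_le (i := s - m) hb' (hp j).mem_pow_idealOfVars (by omega)
    have hw : v - b' * p j ∈ Ideal.span (p '' Set.Iio j) ⊔ 𝔪 ^ (s + 1) := by
      refine hin s ⟨sub_mem hv hpb, Submodule.mem_sup.mpr ⟨a + e * G j,
        add_mem ha (Ideal.mul_mem_right _ _ he), b' * (G j - p j) + d, add_mem hGp hd, ?_⟩⟩
      rw [← hab]
      ring
    rw [Ideal.span_image_Iio_succ, ← sub_add_cancel v (b' * p j)]
    have hle : Ideal.span (p '' Set.Iio j) ⊔ 𝔪 ^ (s + 1) ≤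
        Ideal.span (p '' Set.Iio j) ⊔ Ideal.span {p j} ⊔ 𝔪 ^ (s + 1) :=
      sup_le_sup_right le_sup_left _
    exact add_mem (hle hw) (Ideal.mem_sup_left (Ideal.mem_sup_right
      (Ideal.mul_mem_left _ _ (Ideal.mem_span_singleton_self _))))

theorem mem_span_sup_pow_of_mul_deformation_mem (hp : ∀ i, (p i).IsHomogeneous m)
    (hG : ∀ i, G i - p i ∈ 𝔪 ^ (m + 1)) {j : ℕ}
    (hreg : ∀ i ≤ j, ∀ u, u * p i ∈ Ideal.span (p '' Set.Iio i) → u ∈ Ideal.span (p '' Set.Iio i))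
    {N : ℕ} {u : MvPolynomial σ R} (hu : u * G j ∈ Ideal.span (G '' Set.Iio j) ⊔ 𝔪 ^ N) :
    u ∈ Ideal.span (G '' Set.Iio j) ⊔ 𝔪 ^ (N - m) :=
  mem_span_sup_pow_of_mul_mem_of_initial hp hG (hreg j le_rfl)
    (pow_inf_span_sup_pow_le hp hG fun i hi => hreg i hi.le) hu

end Deformation

end MvPolynomial

/-! ### Dimension count for truncated quotients -/

/-- Additivity of dimension along `0 → A ⧸ (I : g) → A ⧸ I → A ⧸ (I + (g)) → 0`. -/
theorem Ideal.finrank_quotient_eq_add {K A : Type*} [Field K] [CommRing A] [Algebra K A]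
    {I I' : Ideal A} {g : A} (h : ∀ u, u * g ∈ I ↔ u ∈ I') [Module.Finite K (A ⧸ I)] :
    Module.finrank K (A ⧸ I) =
      Module.finrank K (A ⧸ I ⊔ Ideal.span {g}) + Module.finrank K (A ⧸ I') := by
  let φ : (A ⧸ I') →ₗ[K] (A ⧸ I) := (Submodule.mapQ I' I (LinearMap.mulRight A g)
    fun u hu => (h u).mpr hu).restrictScalars K
  let ψ : (A ⧸ I) →ₗ[K] (A ⧸ I ⊔ Ideal.span {g}) :=
    (Ideal.Quotient.factorₐ K (le_sup_left : I ≤ I ⊔ Ideal.span {g})).toLinearMap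
  have hφ : Function.Injective φ := by
    rw [injective_iff_map_eq_zero]
    intro x hx
    obtain ⟨u, rfl⟩ := Ideal.Quotient.mk_surjective x
    exact Ideal.Quotient.eq_zero_iff_mem.mpr
      ((h u).mp (Ideal.Quotient.eq_zero_iff_mem.mp (hx : Ideal.Quotient.mk I (u * g) = 0)))
  have hψ : Function.Surjective ψ := by
    intro x
    obtain ⟨u, rfl⟩ := Ideal.Quotient.mk_surjective x
    exact ⟨Ideal.Quotient.mk I u, rfl⟩
  have hker : LinearMap.ker ψ = LinearMap.range φ := by
    ext x
    obtain ⟨u, rfl⟩ := Ideal.Quotient.mk_surjective x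
    rw [LinearMap.mem_ker, LinearMap.mem_range]
    constructor
    · intro hx
      have hu : u ∈ I ⊔ Ideal.span {g} :=
        Ideal.Quotient.eq_zero_iff_mem.mp (hx : Ideal.Quotient.mk (I ⊔ Ideal.span {g}) u = 0)
      obtain ⟨v, hv, w, hw, rfl⟩ := Submodule.mem_sup.mp hu
      obtain ⟨a, rfl⟩ := Ideal.mem_span_singleton'.mp hw
      refine ⟨Ideal.Quotient.mk I' a, ?_⟩
      change Ideal.Quotient.mk I (a * g) = Ideal.Quotient.mk I (v + a * g)
      rw [map_add, Ideal.Quotient.eq_zero_iff_mem.mpr hv, zero_add]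
    · rintro ⟨y, hy⟩
      obtain ⟨a, rfl⟩ := Ideal.Quotient.mk_surjective y
      rw [← hy]
      exact Ideal.Quotient.eq_zero_iff_mem.mpr (Ideal.mem_sup_right
        (Ideal.mul_mem_left _ a (Ideal.mem_span_singleton_self g)))
  have h1 := LinearMap.finrank_range_add_finrank_ker ψ
  rw [hker, LinearMap.range_eq_top.mpr hψ, finrank_top, LinearMap.finrank_range_of_inj hφ] at h1
  exact h1.symm

namespace MvPolynomial

section Dimension

variable (σ K : Type*) [Field K]

/-- The dimension of `K[σ] ⧸ ((G 0, …, G (j - 1)) + 𝔪 ^ N)` for elements `G i` whose initial forms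
are a regular sequence of forms of degree `m`. -/
noncomputable def truncatedDim (m : ℕ) : ℕ → ℕ → ℕ
  | 0, N => Module.finrank K (MvPolynomial σ K ⧸ idealOfVars σ K ^ N)
  | j + 1, N => truncatedDim m j N - truncatedDim m j (N - m)

variable {σ K} {m : ℕ} {p G : ℕ → MvPolynomial σ K}

/-- The elements multiplied by `G j` into `(G i)_{i < j} + 𝔪 ^ N` are exactly those of `(G i)_{i <
j} + 𝔪 ^ (N - m)`. Additivity of dimension then becomes the recursion of `truncatedDim`. -/
theorem finrank_quotient_span_sup_pow [Finite σ] (hp : ∀ i, (p i).IsHomogeneous m)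
    (hG : ∀ i, G i - p i ∈ idealOfVars σ K ^ (m + 1)) {j : ℕ}
    (hreg : ∀ i < j, ∀ u, u * p i ∈ Ideal.span (p '' Set.Iio i) → u ∈ Ideal.span (p '' Set.Iio i))
    (N : ℕ) :
    Module.finrank K (MvPolynomial σ K ⧸ Ideal.span (G '' Set.Iio j) ⊔ idealOfVars σ K ^ N) =
      truncatedDim σ K m j N := by
  induction j generalizing N with
  | zero =>
    have : Ideal.span (G '' Set.Iio 0) ⊔ idealOfVars σ K ^ N = idealOfVars σ K ^ N := by simp
    rw [this, truncatedDim]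
  | succ j ih =>
    have hGm : G j ∈ idealOfVars σ K ^ m := by
      have := add_mem (Ideal.pow_le_pow_right (Nat.le_succ m) (hG j)) (hp j).mem_pow_idealOfVars
      rwa [sub_add_cancel] at this
    have ih' := ih fun i hi => hreg i (by omega)
    have key : ∀ u, u * G j ∈ Ideal.span (G '' Set.Iio j) ⊔ idealOfVars σ K ^ N ↔
        u ∈ Ideal.span (G '' Set.Iio j) ⊔ idealOfVars σ K ^ (N - m) := by
      intro u
      refine ⟨mem_span_sup_pow_of_mul_deformation_mem hp hG fun i hi => hreg i (by omega), ?_⟩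
      intro hu
      obtain ⟨v, hv, w, hw, rfl⟩ := Submodule.mem_sup.mp hu
      rw [add_mul]
      exact add_mem (Ideal.mem_sup_left (Ideal.mul_mem_right _ _ hv))
        (Ideal.mem_sup_right (Ideal.mul_mem_pow_of_le (i := N - m) hw hGm (by omega)))
    have hfin : Module.Finite K
        (MvPolynomial σ K ⧸ Ideal.span (G '' Set.Iio j) ⊔ idealOfVars σ K ^ N) :=
      Module.Finite.of_surjective (Ideal.Quotient.factorₐ K
        (le_sup_right : idealOfVars σ K ^ N ≤
          Ideal.span (G '' Set.Iio j) ⊔ idealOfVars σ K ^ N)).toLinearMap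
        (Ideal.Quotient.factor_surjective le_sup_right)
    have h := Ideal.finrank_quotient_eq_add (K := K) key
    rw [ih', ih', sup_right_comm, ← Ideal.span_image_Iio_succ] at h
    rw [truncatedDim]
    -- `h` is an equation between sums, so the truncated subtraction in `truncatedDim` is a true
    -- one.
    omega

end Dimension

end MvPolynomial

/-! ### Depth through vanishing of Ext -/

section Depth

open CategoryTheory Abelian

universe u

variable {R : Type u} [CommRing R]

/-- Dividing out an element that is regular modulo `I` lowers the range of vanishing of
`Ext N (R ⧸ I)` by one. -/
theorem subsingleton_ext_quotient_sup_span {N : ModuleCat.{u} R} {I : Ideal R} {q : R}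
    (hq : ∀ u, u * q ∈ I → u ∈ I) {r : ℕ}
    (h : ∀ i < r + 1, Subsingleton (Ext N (ModuleCat.of R (R ⧸ I)) i)) :
    ∀ i < r, Subsingleton (Ext N (ModuleCat.of R (R ⧸ I ⊔ Ideal.span {q})) i) := by
  intro i hi
  let φ : (R ⧸ I) →ₗ[R] (R ⧸ I) := Submodule.mapQ I I (LinearMap.mulRight R q)
    fun u hu => Ideal.mul_mem_right _ _ hu
  let ψ : (R ⧸ I) →ₗ[R] (R ⧸ I ⊔ Ideal.span {q}) := Submodule.factor le_sup_left
  have hφ : Function.Injective φ := by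
    rw [injective_iff_map_eq_zero]
    intro x hx
    obtain ⟨u, rfl⟩ := Ideal.Quotient.mk_surjective x
    exact Ideal.Quotient.eq_zero_iff_mem.mpr
      (hq u (Ideal.Quotient.eq_zero_iff_mem.mp (hx : Ideal.Quotient.mk I (u * q) = 0)))
  have hψ : Function.Surjective ψ := by
    intro x
    obtain ⟨u, rfl⟩ := Ideal.Quotient.mk_surjective x
    exact ⟨Ideal.Quotient.mk I u, rfl⟩
  have hexact : Function.Exact φ ψ := by
    intro x
    obtain ⟨u, rfl⟩ := Ideal.Quotient.mk_surjective x
    constructor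
    · intro hx
      have hu : u ∈ I ⊔ Ideal.span {q} :=
        Ideal.Quotient.eq_zero_iff_mem.mp (hx : Ideal.Quotient.mk (I ⊔ Ideal.span {q}) u = 0)
      obtain ⟨v, hv, w, hw, rfl⟩ := Submodule.mem_sup.mp hu
      obtain ⟨a, rfl⟩ := Ideal.mem_span_singleton'.mp hw
      refine ⟨Ideal.Quotient.mk I a, ?_⟩
      change Ideal.Quotient.mk I (a * q) = Ideal.Quotient.mk I (v + a * q)
      rw [map_add, Ideal.Quotient.eq_zero_iff_mem.mpr hv, zero_add]
    · rintro ⟨y, hy⟩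
      obtain ⟨a, rfl⟩ := Ideal.Quotient.mk_surjective y
      rw [← hy]
      exact Ideal.Quotient.eq_zero_iff_mem.mpr (Ideal.mem_sup_right
        (Ideal.mul_mem_left _ a (Ideal.mem_span_singleton_self q)))
  have hS := ModuleCat.shortComplex_shortExact
    (ModuleCat.shortComplexOfCompEqZero φ ψ hexact.linearMap_comp_eq_zero) hexact hφ hψ
  have zero1 := AddCommGrpCat.isZero_of_iff_subsingleton.mpr (h i (by omega))
  have zero2 := AddCommGrpCat.isZero_of_iff_subsingleton.mpr (h (i + 1) (by omega))
  exact AddCommGrpCat.subsingleton_of_isZero <| ShortComplex.Exact.isZero_of_both_zeros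
    ((Ext.covariant_sequence_exact₃' N hS) i (i + 1) rfl)
    (zero1.eq_zero_of_src _) (zero2.eq_zero_of_tgt _)

/-- If `𝔞` has depth at least `n` on `R`, the quotient by a weakly regular sequence of length
less than `n` has no nonzero element killed by `𝔞`. -/
theorem mem_span_of_forall_mul_mem {n j : ℕ} (hj : j < n) {𝔞 : Ideal R}
    (hext : ∀ i < n, Subsingleton
      (Ext (ModuleCat.of R (R ⧸ 𝔞)) (ModuleCat.of R (R ⧸ (⊥ : Ideal R))) i))
    {q : ℕ → R}
    (hq : ∀ i < j, ∀ u, u * q i ∈ Ideal.span (q '' Set.Iio i) → u ∈ Ideal.span (q '' Set.Iio i))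
    {u : R} (hu : ∀ a ∈ 𝔞, a * u ∈ Ideal.span (q '' Set.Iio j)) :
    u ∈ Ideal.span (q '' Set.Iio j) := by
  have main : ∀ j ≤ n, (∀ i < j, ∀ u, u * q i ∈ Ideal.span (q '' Set.Iio i) →
      u ∈ Ideal.span (q '' Set.Iio i)) → ∀ i < n - j, Subsingleton (Ext (ModuleCat.of R (R ⧸ 𝔞))
        (ModuleCat.of R (R ⧸ Ideal.span (q '' Set.Iio j))) i) := by
    intro j
    induction j with
    | zero =>
      intro _ _ i hi
      have h0 : Ideal.span (q '' Set.Iio 0) = ⊥ := by simp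
      rw [h0]
      exact hext i hi
    | succ j ih =>
      intro hj hq i hi
      rw [Ideal.span_image_Iio_succ]
      refine subsingleton_ext_quotient_sup_span (hq j (Nat.lt_succ_self j))
        (r := n - (j + 1)) ?_ i hi
      intro i hi
      exact ih (by omega) (fun i hi => hq i (by omega)) i (by omega)
  have h0 := main j hj.le hq 0 (by omega)
  have : Subsingleton (ModuleCat.of R (R ⧸ 𝔞) ⟶
      ModuleCat.of R (R ⧸ Ideal.span (q '' Set.Iio j))) := Ext.addEquiv₀.subsingleton_congr.mp h0
  have hlin : Subsingleton ((R ⧸ 𝔞) →ₗ[R] (R ⧸ Ideal.span (q '' Set.Iio j))) :=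
    (ModuleCat.homAddEquiv (M := ModuleCat.of R (R ⧸ 𝔞))
      (N := ModuleCat.of R (R ⧸ Ideal.span (q '' Set.Iio j)))).symm.subsingleton
  -- The map `1 ↦ u` is well defined because `𝔞` kills the class of `u`; it is zero since `Ext⁰`,
  -- that is Hom, still vanishes when `j < n`.
  let ℓ : (R ⧸ 𝔞) →ₗ[R] (R ⧸ Ideal.span (q '' Set.Iio j)) :=
    Submodule.liftQ 𝔞 ((Submodule.mkQ _).comp (LinearMap.mulRight R u)) (by
      intro a ha
      exact Ideal.Quotient.eq_zero_iff_mem.mpr (hu a ha))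
  have h1 := LinearMap.congr_fun (Subsingleton.elim ℓ 0) (Ideal.Quotient.mk 𝔞 1)
  have h2 : Ideal.Quotient.mk (Ideal.span (q '' Set.Iio j)) (1 * u) = 0 := h1
  rwa [one_mul, Ideal.Quotient.eq_zero_iff_mem] at h2

end Depth

/-! ### The polynomial ring has depth `n` along the ideal of variables -/

namespace MvPolynomial

open RingTheory.Sequence CategoryTheory Abelian

universe u

variable {K : Type u} [Field K]

theorem isRegular_X_list (n : ℕ) : IsRegular (MvPolynomial (Fin n) K)
    (List.ofFn (X : Fin n → MvPolynomial (Fin n) K)) := by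
  have hspan : ∀ i, Ideal.ofList ((List.ofFn (X : Fin n → MvPolynomial (Fin n) K)).take i) =
      Ideal.span (X '' {k : Fin n | (k : ℕ) < i}) := by
    intro i
    rw [Ideal.ofList]
    congr 1
    ext a
    simp only [Set.mem_ofPred_eq, List.mem_take_iff_getElem, Set.mem_image, List.getElem_ofFn,
      List.length_ofFn]
    constructor
    · rintro ⟨k, hk, rfl⟩
      exact ⟨⟨k, by omega⟩, by simp; omega, rfl⟩
    · rintro ⟨k, hk, rfl⟩
      exact ⟨k, by have := k.2; omega, rfl⟩
  refine ⟨⟨fun i hi => ?_⟩, ?_⟩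
  · rw [hspan, isSMulRegular_quotient_iff_mem_of_smul_mem]
    intro u hu
    rw [List.getElem_ofFn, smul_eq_mul, smul_eq_mul, Ideal.mul_top, mem_ideal_span_X_image] at hu
    rw [smul_eq_mul, Ideal.mul_top, mem_ideal_span_X_image]
    intro m hm
    rw [List.length_ofFn] at hi
    -- Membership in an ideal generated by variables is read off monomial by monomial: if `Xᵢ` times
    -- a monomial involves an earlier variable, then so does the monomial.
    obtain ⟨k, hk, hk'⟩ := hu (Finsupp.single ⟨i, hi⟩ 1 + m) (by
      rw [mem_support_iff, mul_comm, add_comm, coeff_mul_X]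
      exact mem_support_iff.mp hm)
    refine ⟨k, hk, ?_⟩
    have : k ≠ ⟨i, hi⟩ := by
      rintro rfl
      simp at hk
    simpa [Finsupp.single_apply, this.symm] using hk'
  · intro h
    have h1 := h.le (Submodule.mem_top (x := (1 : MvPolynomial (Fin n) K)))
    have h2 := hspan n
    rw [List.take_of_length_le (by simp)] at h2
    rw [h2, smul_eq_mul, Ideal.mul_top, mem_ideal_span_X_image] at h1
    obtain ⟨i, -, hi⟩ := h1 0 (by simp)
    simp at hi

/-- Rees's criterion for the regular sequence of variables. The ring appears as a quotient by `⊥`,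
which is the ideal of the empty sequence from which `mem_span_of_forall_mul_mem` starts. -/
theorem subsingleton_ext_quotient_idealOfVars (n : ℕ) : ∀ i < n, Subsingleton
    (Ext (ModuleCat.of (MvPolynomial (Fin n) K) (MvPolynomial (Fin n) K ⧸ idealOfVars (Fin n) K))
      (ModuleCat.of (MvPolynomial (Fin n) K)
        (MvPolynomial (Fin n) K ⧸ (⊥ : Ideal (MvPolynomial (Fin n) K)))) i) := by
  have hreg : IsRegular (MvPolynomial (Fin n) K ⧸ (⊥ : Ideal (MvPolynomial (Fin n) K)))
      (List.ofFn (X : Fin n → MvPolynomial (Fin n) K)) :=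
    ((Submodule.quotEquivOfEqBot ⊥ rfl).isRegular_congr _).mpr (isRegular_X_list n)
  have hmem : ∀ r ∈ List.ofFn (X : Fin n → MvPolynomial (Fin n) K), r ∈ idealOfVars (Fin n) K := by
    intro r hr
    obtain ⟨i, rfl⟩ := List.mem_ofFn.mp hr
    exact Ideal.subset_span ⟨i, rfl⟩
  have hle : Ideal.ofList (List.ofFn (X : Fin n → MvPolynomial (Fin n) K)) =
      idealOfVars (Fin n) K := by
    rw [Ideal.ofList]
    congr 1
    ext
    simp
  have h := ModuleCat.subsingleton_ext_of_exists_isRegular (idealOfVars (Fin n) K)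
    (ModuleCat.of _ (MvPolynomial (Fin n) K ⧸ idealOfVars (Fin n) K))
    (by rw [Module.support_eq_zeroLocus, Ideal.annihilator_quotient])
    (ModuleCat.of _ (MvPolynomial (Fin n) K ⧸ (⊥ : Ideal (MvPolynomial (Fin n) K))))
    (by
      rw [lt_top_iff_ne_top, ← hle]
      exact hreg.top_ne_smul.symm) _ hmem hreg
  simpa using h

end MvPolynomial

/-! ### Regular sequences of linear combinations -/

namespace MvPolynomial

universe u

variable {K : Type u} [Field K] {n : ℕ}

/-- If the `p l` generate an ideal containing a power of the ideal of variables, some linear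
combination of them is regular modulo a weakly regular sequence of length less than `n`; its
coefficient vector may be chosen outside a given proper subspace. -/
theorem exists_combination_regular [Infinite K] {p : Fin n → MvPolynomial (Fin n) K} {k : ℕ}
    (hk : idealOfVars (Fin n) K ^ k ≤ Ideal.span (Set.range p))
    {q : ℕ → MvPolynomial (Fin n) K} {j : ℕ} (hj : j < n)
    (hq : ∀ i < j, ∀ u, u * q i ∈ Ideal.span (q '' Set.Iio i) → u ∈ Ideal.span (q '' Set.Iio i))
    {W : Submodule K (Fin n → K)} (hW : W ≠ ⊤) :
    ∃ c ∉ W, ∀ u, u * Fintype.linearCombination K p c ∈ Ideal.span (q '' Set.Iio j) →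
      u ∈ Ideal.span (q '' Set.Iio j) := by
  classical
  set I := Ideal.span (q '' Set.Iio j) with hI
  have hfin := associatedPrimes.finite (MvPolynomial (Fin n) K) (MvPolynomial (Fin n) K ⧸ I)
  let V : Ideal (MvPolynomial (Fin n) K) → Submodule K (Fin n → K) := fun 𝔭 =>
    (𝔭.restrictScalars K).comap (Fintype.linearCombination K p)
  have hV : ∀ 𝔭 ∈ associatedPrimes (MvPolynomial (Fin n) K) (MvPolynomial (Fin n) K ⧸ I),
      V 𝔭 ≠ ⊤ := by
    -- An associated prime containing every `p l` contains all variables. It is the annihilator of a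
    -- class, which would then be killed by `𝔪` and so vanish by the depth bound.
    intro 𝔭 h𝔭 htop
    obtain ⟨hprime, x, hx⟩ := isAssociatedPrime_iff.mp h𝔭
    have hp𝔭 : Ideal.span (Set.range p) ≤ 𝔭 := by
      rw [Ideal.span_le]
      rintro _ ⟨l, rfl⟩
      have h : Pi.single l 1 ∈ V 𝔭 := htop ▸ Submodule.mem_top
      have h' : Fintype.linearCombination K p (Pi.single l 1) ∈ 𝔭 := h
      simpa using h'
    have hvars : idealOfVars (Fin n) K ≤ 𝔭 := Ideal.IsPrime.le_of_pow_le (hk.trans hp𝔭)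
    obtain ⟨u, rfl⟩ := Ideal.Quotient.mk_surjective x
    have hu : u ∈ I := by
      refine mem_span_of_forall_mul_mem hj (subsingleton_ext_quotient_idealOfVars n) hq ?_
      intro a ha
      have := hvars ha
      rw [hx, Submodule.mem_colon_singleton] at this
      exact Ideal.Quotient.eq_zero_iff_mem.mp this
    apply hprime.ne_top
    rw [hx, Ideal.Quotient.eq_zero_iff_mem.mpr hu]
    simp
  -- Over an infinite field, finitely many proper subspaces do not cover the space; including `W`
  -- secures linear independence along with regularity.
  have hs : ⊤ ∉ insert W (hfin.toFinset.image V) := by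
    rw [Finset.mem_insert, Finset.mem_image]
    rintro (h | ⟨𝔭, h𝔭, h⟩)
    · exact hW h.symm
    · exact hV 𝔭 (hfin.mem_toFinset.mp h𝔭) h
  obtain ⟨c, hc⟩ := (Set.ne_univ_iff_exists_notMem _).mp (Subspace.biUnion_ne_univ_of_top_notMem hs)
  simp only [Set.mem_iUnion, not_exists] at hc
  refine ⟨c, hc W (Finset.mem_insert_self _ _), fun u hu => ?_⟩
  have hreg : IsSMulRegular (MvPolynomial (Fin n) K ⧸ I) (Fintype.linearCombination K p c) := by
    by_contra hcon
    have hmem : Fintype.linearCombination K p c ∈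
        {r : MvPolynomial (Fin n) K | IsSMulRegular (MvPolynomial (Fin n) K ⧸ I) r}ᶜ := hcon
    rw [← biUnion_associatedPrimes_eq_compl_regular, Set.mem_iUnion₂] at hmem
    obtain ⟨𝔭, h𝔭, hmem⟩ := hmem
    exact hc (V 𝔭) (Finset.mem_insert_of_mem (Finset.mem_image_of_mem _
      (hfin.mem_toFinset.mpr h𝔭))) hmem
  rw [mul_comm, ← smul_eq_mul] at hu
  exact mem_of_isSMulRegular_quotient_of_smul_mem hreg hu

/-- If the `p l` generate an ideal containing a power of the ideal of variables, independent
linear combinations of them form a weakly regular sequence. -/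
theorem exists_linearIndependent_combinations_regular [Infinite K]
    {p : Fin n → MvPolynomial (Fin n) K} {k : ℕ}
    (hk : idealOfVars (Fin n) K ^ k ≤ Ideal.span (Set.range p)) {j : ℕ} (hj : j ≤ n) :
    ∃ c : ℕ → Fin n → K, LinearIndependent K (fun i : Fin j => c i) ∧
      ∀ i < j, ∀ u, u * Fintype.linearCombination K p (c i) ∈
          Ideal.span ((fun i => Fintype.linearCombination K p (c i)) '' Set.Iio i) →
        u ∈ Ideal.span ((fun i => Fintype.linearCombination K p (c i)) '' Set.Iio i) := by
  induction j with
  | zero => exact ⟨0, linearIndependent_empty_type, by simp⟩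
  | succ j ih =>
    obtain ⟨c, hc, hreg⟩ := ih (by omega)
    have hW : Submodule.span K (Set.range fun i : Fin j => c i) ≠ ⊤ := by
      intro htop
      have h := finrank_span_eq_card hc
      rw [htop, finrank_top, Module.finrank_fin_fun, Fintype.card_fin] at h
      omega
    obtain ⟨c', hc', hreg'⟩ := exists_combination_regular hk hj hreg hW
    have himg : ∀ i ≤ j, (fun i => Fintype.linearCombination K p (Function.update c j c' i)) ''
        Set.Iio i = (fun i => Fintype.linearCombination K p (c i)) '' Set.Iio i := by
      intro i hi
      refine Set.image_congr fun l hl => ?_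
      have hl' : l < i := hl
      rw [Function.update_of_ne (by omega)]
    refine ⟨Function.update c j c', ?_, ?_⟩
    · have hsnoc : (fun i : Fin (j + 1) => Function.update c j c' i) =
          Fin.snoc (α := fun _ => Fin n → K) (fun i : Fin j => c i) c' := by
        funext i
        refine Fin.lastCases ?_ (fun l => ?_) i
        · simp
        · have := l.2
          rw [Fin.snoc_castSucc, Fin.val_castSucc, Function.update_of_ne (by omega)]
      rw [hsnoc, linearIndependent_finSnoc]
      exact ⟨hc, hc'⟩
    · intro i hi u hu
      rw [himg i (by omega)] at hu ⊢
      rcases Nat.lt_succ_iff_lt_or_eq.mp hi with h | rfl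
      · rw [Function.update_of_ne (by omega)] at hu
        exact hreg i h u hu
      · rw [Function.update_self] at hu
        exact hreg' u hu

/-- The `n` independent coefficient vectors span `Kⁿ`, so the change of generators is invertible.
The coefficients chosen for the `p i` can therefore be used for the `G i`. -/
theorem span_linearCombination_eq {A : Type*} [CommRing A] [Algebra K A] {c : ℕ → Fin n → K}
    (hc : LinearIndependent K (fun i : Fin n => c i)) (G : Fin n → A) :
    Ideal.span ((fun i => Fintype.linearCombination K G (c i)) '' Set.Iio n) =
      Ideal.span (Set.range G) := by
  apply le_antisymm
  · rw [Ideal.span_le]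
    rintro _ ⟨i, -, rfl⟩
    rw [SetLike.mem_coe]
    beta_reduce
    rw [Fintype.linearCombination_apply]
    refine Submodule.sum_mem _ fun l _ => ?_
    rw [Algebra.smul_def]
    exact Ideal.mul_mem_left _ _ (Ideal.subset_span ⟨l, rfl⟩)
  · rw [Ideal.span_le]
    rintro _ ⟨l, rfl⟩
    have htop : Submodule.span K (Set.range fun i : Fin n => c i) = ⊤ :=
      hc.span_eq_top_of_card_eq_finrank' (by simp)
    have hle : Submodule.span K (Set.range fun i : Fin n => c i) ≤ ((Ideal.span
        ((fun i => Fintype.linearCombination K G (c i)) '' Set.Iio n)).restrictScalars K).comap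
          (Fintype.linearCombination K G) := by
      rw [Submodule.span_le]
      rintro _ ⟨i, rfl⟩
      exact Ideal.subset_span ⟨i, i.2, rfl⟩
    have hmem : Fintype.linearCombination K G (Pi.single l 1) ∈ Ideal.span
        ((fun i => Fintype.linearCombination K G (c i)) '' Set.Iio n) :=
      hle (htop ▸ Submodule.mem_top)
    simpa using hmem

/-- The dimension of the quotient by `(G 0, …, G (n - 1)) + 𝔪 ^ N` only depends on the degree of
the initial forms of the `G i`, if these forms generate an ideal containing a power of the ideal
of variables. -/
theorem finrank_quotient_span_range_sup_pow [Infinite K] {m k : ℕ}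
    {p G : Fin n → MvPolynomial (Fin n) K} (hp : ∀ i, (p i).IsHomogeneous m)
    (hk : idealOfVars (Fin n) K ^ k ≤ Ideal.span (Set.range p))
    (hG : ∀ i, G i - p i ∈ idealOfVars (Fin n) K ^ (m + 1)) (N : ℕ) :
    Module.finrank K
        (MvPolynomial (Fin n) K ⧸ Ideal.span (Set.range G) ⊔ idealOfVars (Fin n) K ^ N) =
      truncatedDim (Fin n) K m n N := by
  obtain ⟨c, hc, hreg⟩ := exists_linearIndependent_combinations_regular hk le_rfl
  rw [← span_linearCombination_eq hc G]
  refine finrank_quotient_span_sup_pow (p := fun i => Fintype.linearCombination K p (c i))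
    ?_ ?_ hreg N
  · intro i
    rw [Fintype.linearCombination_apply, ← mem_homogeneousSubmodule]
    exact Submodule.sum_mem _ fun l _ => Submodule.smul_mem _ _ (hp l)
  · intro i
    simp only [Fintype.linearCombination_apply, ← Finset.sum_sub_distrib, ← smul_sub]
    refine Submodule.sum_mem _ fun l _ => ?_
    rw [Algebra.smul_def]
    exact Ideal.mul_mem_left _ _ (hG l)

end MvPolynomial

namespace MvPolynomial

/-! ### Passing from polynomials to an algebra with the same Taylor expansions -/

section FormalNeighbourhood

variable {K A : Type*} [Field K] [CommRing A] [Algebra K A] {n : ℕ}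
  {ι : MvPolynomial (Fin n) K →ₐ[K] A}

/-- In a combination of images of elements of `𝔪 ^ k`, replacing each coefficient by its constant
term changes the sum only in order `k + 1`. Iterating this produces Taylor polynomials. -/
theorem exists_mem_pow_sub_mem_pow_succ
    (hconst : ∀ a : A, ∃ c : K, a - algebraMap K A c ∈ (idealOfVars (Fin n) K).map ι)
    {k : ℕ} {a : A} (ha : a ∈ (idealOfVars (Fin n) K).map ι ^ k) :
    ∃ q ∈ idealOfVars (Fin n) K ^ k, a - ι q ∈ (idealOfVars (Fin n) K).map ι ^ (k + 1) := by
  rw [← Ideal.map_pow, Ideal.map, Ideal.span] at ha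
  induction ha using Submodule.closure_induction with
  | zero => exact ⟨0, zero_mem _, by simp⟩
  | add x y _ _ hx hy =>
    obtain ⟨q, hq, hq'⟩ := hx
    obtain ⟨r, hr, hr'⟩ := hy
    refine ⟨q + r, add_mem hq hr, ?_⟩
    rw [map_add, add_sub_add_comm]
    exact add_mem hq' hr'
  | smul_mem b x hx =>
    obtain ⟨w, hw, rfl⟩ := hx
    obtain ⟨c, hc⟩ := hconst b
    refine ⟨C c * w, Ideal.mul_mem_left _ _ hw, ?_⟩
    have hιC : ι (C c) = algebraMap K A c := by
      rw [← algebraMap_eq, AlgHom.commutes]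
    have hw' : ι w ∈ (idealOfVars (Fin n) K).map ι ^ k := by
      rw [← Ideal.map_pow]
      exact Ideal.mem_map_of_mem ι hw
    rw [map_mul, hιC, smul_eq_mul, ← sub_mul, pow_succ']
    exact Ideal.mul_mem_mul hc hw'

theorem exists_sub_mem_pow
    (hconst : ∀ a : A, ∃ c : K, a - algebraMap K A c ∈ (idealOfVars (Fin n) K).map ι)
    (k : ℕ) (a : A) :
    ∃ q, a - ι q ∈ (idealOfVars (Fin n) K).map ι ^ k := by
  induction k with
  | zero => exact ⟨0, by simp⟩
  | succ k ih =>
    obtain ⟨q, hq⟩ := ih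
    obtain ⟨r, -, hr⟩ := exists_mem_pow_sub_mem_pow_succ hconst hq
    refine ⟨q + r, ?_⟩
    rwa [map_add, ← sub_sub]

/-- An ideal of finite codimension contains a power of any ideal contained in the Jacobson
radical. -/
theorem exists_pow_le_of_finite_quotient {M I : Ideal A} (hM : M ≤ Ideal.jacobson ⊥)
    [Module.Finite K (A ⧸ I)] : ∃ k, M ^ k ≤ I := by
  have : IsArtinianRing (A ⧸ I) := IsArtinianRing.of_finite K (A ⧸ I)
  obtain ⟨k, hk⟩ := IsArtinianRing.isNilpotent_jacobson_bot (R := A ⧸ I)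
  refine ⟨k, ?_⟩
  have hle : M.map (Ideal.Quotient.mk I) ≤ Ideal.jacobson ⊥ := by
    rw [Ideal.map_le_iff_le_comap, Ideal.comap_jacobson_of_surjective Ideal.Quotient.mk_surjective]
    exact hM.trans (Ideal.jacobson_mono bot_le)
  have h := Ideal.pow_right_mono hle k
  rw [hk, ← Ideal.map_pow, Ideal.zero_eq_bot, le_bot_iff, Ideal.map_eq_bot_iff_le_ker,
    Ideal.mk_ker] at h
  exact h

theorem mem_span_sup_pow_of_map_mem
    (hconst : ∀ a : A, ∃ c : K, a - algebraMap K A c ∈ (idealOfVars (Fin n) K).map ι)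
    (hinj : ∀ q k, ι q ∈ (idealOfVars (Fin n) K).map ι ^ k → q ∈ idealOfVars (Fin n) K ^ k)
    {F : Fin n → A} {G : Fin n → MvPolynomial (Fin n) K} {N : ℕ}
    (hFG : ∀ i, F i - ι (G i) ∈ (idealOfVars (Fin n) K).map ι ^ N)
    {u : MvPolynomial (Fin n) K} (hu : ι u ∈ Ideal.span (Set.range F)) :
    u ∈ Ideal.span (Set.range G) ⊔ idealOfVars (Fin n) K ^ N := by
  obtain ⟨e, he⟩ := Ideal.mem_span_range_iff_exists_fun.mp hu
  choose a ha using fun i => exists_sub_mem_pow hconst N (e i)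
  have h1 : u - ∑ i, a i * G i ∈ idealOfVars (Fin n) K ^ N := by
    apply hinj
    have h2 : ι (u - ∑ i, a i * G i) =
        ∑ i, (e i * (F i - ι (G i)) + (e i - ι (a i)) * ι (G i)) := by
      rw [map_sub, ← he, map_sum, ← Finset.sum_sub_distrib]
      refine Finset.sum_congr rfl fun i _ => ?_
      rw [map_mul]
      ring
    rw [h2]
    exact Submodule.sum_mem _ fun i _ => add_mem (Ideal.mul_mem_left _ _ (hFG i))
      (Ideal.mul_mem_right _ _ (ha i))
  refine Submodule.mem_sup.mpr ⟨∑ i, a i * G i, ?_, _, h1, by ring⟩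
  exact Submodule.sum_mem _ fun i _ => Ideal.mul_mem_left _ _ (Ideal.subset_span ⟨i, rfl⟩)

theorem pow_idealOfVars_le_span_of_map
    (hconst : ∀ a : A, ∃ c : K, a - algebraMap K A c ∈ (idealOfVars (Fin n) K).map ι)
    (hinj : ∀ q k, ι q ∈ (idealOfVars (Fin n) K).map ι ^ k → q ∈ idealOfVars (Fin n) K ^ k)
    {m k : ℕ} {p : Fin n → MvPolynomial (Fin n) K} (hp : ∀ i, (p i).IsHomogeneous m)
    (hk : (idealOfVars (Fin n) K).map ι ^ k ≤ Ideal.span (Set.range fun i => ι (p i))) :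
    idealOfVars (Fin n) K ^ k ≤ Ideal.span (Set.range p) := by
  rw [pow_idealOfVars_eq_span, Ideal.span_le]
  rintro _ ⟨x, hx, rfl⟩
  have hx' : x.degree = k := hx
  have hhom : (monomial x (1 : K)).IsHomogeneous k := isHomogeneous_monomial _ hx'
  refine mem_span_of_mem_sup_pow (m := m) (d := k) ?_ hhom ?_
  · rintro _ ⟨i, rfl⟩
    exact hp i
  -- The generators are themselves images of polynomials, so the approximation error is zero and the
  -- truncation order can be chosen freely, here `k + 1 + m`.
  · refine mem_span_sup_pow_of_map_mem (F := fun i => ι (p i)) hconst hinj (by simp) (hk ?_)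
    rw [← Ideal.map_pow]
    exact Ideal.mem_map_of_mem ι hhom.mem_pow_idealOfVars

/-- If forms `p i` of degree `m` generate an ideal containing a power of the maximal ideal, so do
all elements with these initial forms. -/
theorem map_pow_le_span_of_sub_mem (hjac : (idealOfVars (Fin n) K).map ι ≤ Ideal.jacobson ⊥)
    {m k : ℕ} {p : Fin n → MvPolynomial (Fin n) K} (hp : ∀ i, (p i).IsHomogeneous m)
    (hk : idealOfVars (Fin n) K ^ k ≤ Ideal.span (Set.range p))
    {F : Fin n → A} (hF : ∀ i, F i - ι (p i) ∈ (idealOfVars (Fin n) K).map ι ^ (m + 1)) :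
    (idealOfVars (Fin n) K).map ι ^ k ≤ Ideal.span (Set.range F) := by
  set M := (idealOfVars (Fin n) K).map ι with hM
  have hfg : M.FG := Ideal.FG.map (idealOfVars_fg (Fin n) K) ι.toRingHom
  have h1 : idealOfVars (Fin n) K ^ k ≤
      idealOfVars (Fin n) K ^ (k - m) * Ideal.span (Set.range p) := by
    intro u hu
    refine span_inf_pow_le_mul_span k ?_ ⟨hk hu, hu⟩
    rintro _ ⟨i, rfl⟩
    exact hp i
  have h2 : (Ideal.span (Set.range p)).map ι ≤ Ideal.span (Set.range F) ⊔ M ^ (m + 1) := by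
    rw [Ideal.map_span, Ideal.span_le]
    rintro _ ⟨_, ⟨i, rfl⟩, rfl⟩
    exact Submodule.mem_sup.mpr ⟨F i, Ideal.subset_span ⟨i, rfl⟩, -(F i - ι (p i)),
      neg_mem (hF i), by simp⟩
  have h3 : M ^ k ≤ M ^ (k - m) * (Ideal.span (Set.range p)).map ι := by
    have := Ideal.map_mono (f := ι) h1
    rwa [Ideal.map_mul, Ideal.map_pow, Ideal.map_pow] at this
  have h4 : M ^ (k - m) * (Ideal.span (Set.range F) ⊔ M ^ (m + 1)) ≤
      Ideal.span (Set.range F) ⊔ M ^ (k + 1) := by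
    rw [Ideal.mul_sup, ← pow_add]
    exact sup_le_sup Ideal.mul_le_right (Ideal.pow_le_pow_right (by omega))
  have h5 : M ^ k ≤ Ideal.span (Set.range F) ⊔ M ^ (k + 1) :=
    (h3.trans (Ideal.mul_mono_right h2)).trans h4
  rw [pow_succ'] at h5
  -- Nakayama's lemma for the finitely generated ideal `M ^ k`.
  exact Submodule.le_of_le_smul_of_le_jacobson_bot hfg.pow hjac h5

/-- Let `A` be an algebra with the same formal neighbourhood as the origin of affine `n`-space, and
let `F i` be elements of `A` whose initial forms `p i` are of degree `m` and generate an ideal of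
finite codimension. Then the codimension of the ideal generated by the `F i` only depends on `m`
and `n`. -/
theorem rank_quotient_span_eq [Infinite K]
    (hjac : (idealOfVars (Fin n) K).map ι ≤ Ideal.jacobson ⊥)
    (hconst : ∀ a : A, ∃ c : K, a - algebraMap K A c ∈ (idealOfVars (Fin n) K).map ι)
    (hinj : ∀ q k, ι q ∈ (idealOfVars (Fin n) K).map ι ^ k → q ∈ idealOfVars (Fin n) K ^ k)
    {m : ℕ} {p : Fin n → MvPolynomial (Fin n) K} (hp : ∀ i, (p i).IsHomogeneous m)
    [Module.Finite K (A ⧸ Ideal.span (Set.range fun i => ι (p i)))]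
    {F : Fin n → A} (hF : ∀ i, F i - ι (p i) ∈ (idealOfVars (Fin n) K).map ι ^ (m + 1)) :
    ∃ N₀, ∀ N ≥ N₀, Module.rank K (A ⧸ Ideal.span (Set.range F)) =
      truncatedDim (Fin n) K m n N := by
  obtain ⟨k, hk⟩ := exists_pow_le_of_finite_quotient (K := K)
    (I := Ideal.span (Set.range fun i => ι (p i))) hjac
  have hkp := pow_idealOfVars_le_span_of_map hconst hinj hp hk
  have hkF := map_pow_le_span_of_sub_mem hjac hp hkp hF
  -- `N ≥ k` puts `M ^ N` inside the ideal of the `F i`; `N ≥ m + 1` ensures that the Taylor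
  -- polynomials `G i` keep the initial forms `p i`.
  refine ⟨max k (m + 1), fun N hN => ?_⟩
  set M := (idealOfVars (Fin n) K).map ι with hM
  choose G hG using fun i => exists_sub_mem_pow hconst N (F i)
  have hNF : M ^ N ≤ Ideal.span (Set.range F) :=
    (Ideal.pow_le_pow_right (le_trans (le_max_left _ _) hN)).trans hkF
  have hGp : ∀ i, G i - p i ∈ idealOfVars (Fin n) K ^ (m + 1) := by
    intro i
    apply hinj
    have h := sub_mem (hF i) (Ideal.pow_le_pow_right (le_trans (le_max_right _ _) hN) (hG i))
    rwa [sub_sub_sub_cancel_left, ← map_sub] at h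
  let φ : MvPolynomial (Fin n) K →ₐ[K] A ⧸ Ideal.span (Set.range F) :=
    (Ideal.Quotient.mkₐ K (Ideal.span (Set.range F))).comp ι
  have hφ : Function.Surjective φ := by
    intro x
    obtain ⟨a, rfl⟩ := Ideal.Quotient.mk_surjective x
    obtain ⟨q, hq⟩ := exists_sub_mem_pow hconst N a
    exact ⟨q, (Ideal.Quotient.eq.mpr (hNF hq)).symm⟩
  have hker : RingHom.ker φ = Ideal.span (Set.range G) ⊔ idealOfVars (Fin n) K ^ N := by
    have hmem : ∀ u, u ∈ RingHom.ker φ ↔ ι u ∈ Ideal.span (Set.range F) := fun u =>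
      Ideal.Quotient.eq_zero_iff_mem
    apply le_antisymm
    · intro u hu
      exact mem_span_sup_pow_of_map_mem hconst hinj hG ((hmem u).mp hu)
    · refine sup_le ?_ ?_
      · rw [Ideal.span_le]
        rintro _ ⟨i, rfl⟩
        refine (hmem _).mpr ?_
        rw [← sub_sub_cancel (F i) (ι (G i))]
        exact sub_mem (Ideal.subset_span ⟨i, rfl⟩) (hNF (hG i))
      · intro u hu
        refine (hmem _).mpr (hNF ?_)
        rw [hM, ← Ideal.map_pow]
        exact Ideal.mem_map_of_mem ι hu
  have e : (MvPolynomial (Fin n) K ⧸ Ideal.span (Set.range G) ⊔ idealOfVars (Fin n) K ^ N) ≃ₐ[K]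
      A ⧸ Ideal.span (Set.range F) :=
    (Ideal.quotientEquivAlgOfEq K hker.symm).trans (Ideal.quotientKerAlgEquivOfSurjective hφ)
  have hfin : Module.Finite K
      (MvPolynomial (Fin n) K ⧸ Ideal.span (Set.range G) ⊔ idealOfVars (Fin n) K ^ N) :=
    Module.Finite.of_surjective (Ideal.Quotient.factorₐ K
      (le_sup_right : idealOfVars (Fin n) K ^ N ≤
        Ideal.span (Set.range G) ⊔ idealOfVars (Fin n) K ^ N)).toLinearMap
      (Ideal.Quotient.factor_surjective le_sup_right)
  have hfin' : Module.Finite K (A ⧸ Ideal.span (Set.range F)) :=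
    Module.Finite.equiv e.toLinearEquiv
  rw [← Module.finrank_eq_rank, ← e.toLinearEquiv.finrank_eq,
    finrank_quotient_span_range_sup_pow hp hkp hGp N]

end FormalNeighbourhood

end MvPolynomial

/-! ### Hadamard's lemma for smooth germs -/

section Hadamard

open MeasureTheory

/-- The integral is the value at `0` of the convolution of the indicator of `(0, 1]` with a smooth
compactly supported kernel depending on `x`. The cutoff `χ` equals `1` on `[-2, 2]`, hence does not
alter the integral. -/
theorem contDiff_integral_zero_one {E : Type*} [NormedAddCommGroup E] [NormedSpace ℝ E]
    {G : E × ℝ → ℝ} (hG : ContDiff ℝ ∞ G) :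
    ContDiff ℝ ∞ fun x => ∫ t in (0 : ℝ)..1, G (x, t) := by
  let χ : ContDiffBump (0 : ℝ) := ⟨2, 3, by norm_num, by norm_num⟩
  have hf : LocallyIntegrable (Set.indicator (Set.Ioc (0 : ℝ) 1) fun _ => (1 : ℝ)) :=
    ((integrable_indicator_iff measurableSet_Ioc).mpr
      (integrableOn_const (by simp) (by simp))).locallyIntegrable
  have hg : ContDiff ℝ ∞ (fun y : E × ℝ => χ y.2 * G (y.1, -y.2)) :=
    (χ.contDiff.comp contDiff_snd).mul (hG.comp (contDiff_fst.prodMk contDiff_snd.neg))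
  have h := contDiffOn_convolution_right_with_param_comp (n := ⊤) (μ := volume)
    (ContinuousLinearMap.mul ℝ ℝ)
    (v := fun _ : E => (0 : ℝ)) contDiffOn_const
    (g := fun (x : E) (t : ℝ) => χ t * G (x, -t)) isOpen_univ (isCompact_closedBall (0 : ℝ) 3)
    (by
      intro x t _ ht
      have : χ t = 0 := χ.zero_of_le_dist (le_of_lt (by simpa using ht))
      simp [this]) hf hg.contDiffOn
  rw [contDiffOn_univ] at h
  convert h using 2 with x
  rw [intervalIntegral.integral_of_le zero_le_one, ← integral_indicator measurableSet_Ioc]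
  simp only [convolution, ContinuousLinearMap.mul_apply', zero_sub, neg_neg]
  refine integral_congr_ae (Eventually.of_forall fun t => ?_)
  by_cases ht : t ∈ Set.Ioc (0 : ℝ) 1
  · have : χ (-t) = 1 := χ.one_of_mem_closedBall (by
      rw [Metric.mem_closedBall, dist_zero_right, norm_neg, Real.norm_eq_abs, abs_of_pos ht.1]
      exact ht.2.trans (by norm_num))
    simp [ht, this]
  · simp [ht]

theorem IsSmoothGerm.exists_contDiff {n : ℕ} {f : RSpace n → ℝ} (hf : IsSmoothGerm f) :
    ∃ F : RSpace n → ℝ, ContDiff ℝ ∞ F ∧ F =ᶠ[𝓝 0] f := by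
  obtain ⟨r, hr, hball⟩ := Metric.eventually_nhds_iff_ball.mp hf
  let χ : ContDiffBump (0 : RSpace n) := ⟨r / 3, r / 2, by positivity, by linarith⟩
  refine ⟨fun x => χ x * f x, ?_, ?_⟩
  · rw [contDiff_iff_contDiffAt]
    intro x
    by_cases hx : x ∈ Metric.ball (0 : RSpace n) r
    · exact χ.contDiffAt.mul (hball x hx)
    · have hx' : x ∉ tsupport χ := by
        rw [χ.tsupport_eq]
        intro h
        apply hx
        exact Metric.closedBall_subset_ball (by change r / 2 < r; linarith) h
      have hev : (fun x => χ x * f x) =ᶠ[𝓝 x] fun _ => 0 := by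
        filter_upwards [notMem_tsupport_iff_eventuallyEq.mp hx'] with y hy
        simp [hy]
      exact contDiffAt_const.congr_of_eventuallyEq hev
  · filter_upwards [χ.eventuallyEq_one] with x hx
    simp [hx]

/-- **Hadamard's lemma**: a smooth germ vanishing at `0` is a combination of the coordinates with
smooth coefficients. -/
theorem IsSmoothGerm.exists_eq_sum_mul {n : ℕ} {f : RSpace n → ℝ} (hf : IsSmoothGerm f)
    (h0 : f 0 = 0) : ∃ g : Fin n → RSpace n → ℝ, (∀ i, IsSmoothGerm (g i)) ∧
      f =ᶠ[𝓝 0] fun x => ∑ i, x i * g i x := by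
  obtain ⟨F, hF, hFf⟩ := hf.exists_contDiff
  have hF' : ContDiff ℝ ∞ (fderiv ℝ F) := hF.fderiv_right (by simp)
  refine ⟨fun i x => ∫ t in (0 : ℝ)..1, fderiv ℝ F (t • x) (EuclideanSpace.single i 1), ?_, ?_⟩
  · intro i
    refine Eventually.of_forall fun x => ContDiff.contDiffAt ?_
    exact contDiff_integral_zero_one (G := fun y : RSpace n × ℝ =>
      fderiv ℝ F (y.2 • y.1) (EuclideanSpace.single i 1))
      ((hF'.comp (contDiff_snd.smul contDiff_fst)).clm_apply contDiff_const)
  · filter_upwards [hFf] with x hx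
    have hcont : Continuous fun t : ℝ => fderiv ℝ F (t • x) :=
      hF'.continuous.comp (continuous_id.smul continuous_const)
    have hderiv : ∀ t ∈ Set.uIcc (0 : ℝ) 1,
        HasDerivAt (fun t : ℝ => F (t • x)) (fderiv ℝ F (t • x) x) t := by
      intro t _
      have h1 : HasFDerivAt F (fderiv ℝ F (t • x)) (t • x) :=
        ((hF.differentiable (by simp)) _).hasFDerivAt
      have h2 : HasDerivAt (fun t : ℝ => t • x) x t := by
        simpa using (hasDerivAt_id t).smul_const x
      exact h1.comp_hasDerivAt t h2
    have hFTC := intervalIntegral.integral_eq_sub_of_hasDerivAt hderiv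
      ((hcont.clm_apply continuous_const).intervalIntegrable _ _)
    have hF0 : F 0 = 0 := by rw [hFf.self_of_nhds, h0]
    rw [one_smul, zero_smul, hF0, sub_zero, hx] at hFTC
    rw [← hFTC]
    have hx' : x = ∑ i, x i • EuclideanSpace.single i (1 : ℝ) := by
      simpa using ((EuclideanSpace.basisFun (Fin n) ℝ).sum_repr x).symm
    have hexp : ∀ t : ℝ, fderiv ℝ F (t • x) x =
        ∑ i, x i * fderiv ℝ F (t • x) (EuclideanSpace.single i 1) := by
      intro t
      conv_lhs => rw [hx', map_sum]
      rw [← hx']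
      simp
    simp_rw [hexp]
    rw [intervalIntegral.integral_finsetSum]
    · simp_rw [intervalIntegral.integral_const_mul]
    · intro i _
      exact (continuous_const.mul (hcont.clm_apply continuous_const)).intervalIntegrable _ _

end Hadamard

/-! ### The local algebra of smooth germs -/

section GermAlgebra

variable {n : ℕ}

open MvPolynomial

theorem IsSmoothGerm.continuousAt {f : RSpace n → ℝ} (hf : IsSmoothGerm f) : ContinuousAt f 0 :=
  hf.self_of_nhds.continuousAt

theorem smoothGerms_exists_rep (a : smoothGerms n) :
    ∃ (f : RSpace n → ℝ) (hf : IsSmoothGerm f), a = hf.germ := by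
  obtain ⟨_, f, hf, rfl⟩ := a
  exact ⟨f, hf, rfl⟩

theorem IsSmoothGerm.germ_eq_iff {f g : RSpace n → ℝ} (hf : IsSmoothGerm f) (hg : IsSmoothGerm g) :
    hf.germ = hg.germ ↔ f =ᶠ[𝓝 0] g :=
  Subtype.ext_iff.trans Germ.coe_eq

theorem IsSmoothGerm.sub {f g : RSpace n → ℝ} (hf : IsSmoothGerm f) (hg : IsSmoothGerm g) :
    IsSmoothGerm (f - g) := by
  filter_upwards [hf, hg] with x h₁ h₂
  exact h₁.sub h₂

theorem isSmoothGerm_coord (i : Fin n) : IsSmoothGerm fun x : RSpace n => x i :=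
  Eventually.of_forall fun _ => (EuclideanSpace.proj (𝕜 := ℝ) i).contDiff.contDiffAt

/-- The polynomial germs. -/
noncomputable def polyGerm (n : ℕ) : MvPolynomial (Fin n) ℝ →ₐ[ℝ] smoothGerms n :=
  aeval fun i => (isSmoothGerm_coord i).germ

theorem isSmoothGerm_eval (q : MvPolynomial (Fin n) ℝ) :
    IsSmoothGerm fun x : RSpace n => eval (fun i => x i) q := by
  refine Eventually.of_forall fun x => ContDiff.contDiffAt ?_
  induction q using MvPolynomial.induction_on with
  | C a => simpa using contDiff_const
  | add p q hp hq => simpa using hp.add hq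
  | mul_X p i hp => simpa using hp.mul (EuclideanSpace.proj (𝕜 := ℝ) i).contDiff

theorem algebraMap_smoothGerms (c : ℝ) :
    ((algebraMap ℝ (smoothGerms n) c : smoothGerms n) : Germ (𝓝 (0 : RSpace n)) ℝ) =
      ((fun _ => c : RSpace n → ℝ) : Germ (𝓝 (0 : RSpace n)) ℝ) := by
  change algebraMap ℝ (Germ (𝓝 (0 : RSpace n)) ℝ) c = _
  rw [Algebra.algebraMap_eq_smul_one]
  exact congrArg Germ.ofFun (funext fun x => by simp)

theorem polyGerm_eq (q : MvPolynomial (Fin n) ℝ) : polyGerm n q = (isSmoothGerm_eval q).germ := by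
  apply Subtype.ext
  induction q using MvPolynomial.induction_on with
  | C a =>
    rw [← MvPolynomial.algebraMap_eq, AlgHom.commutes, algebraMap_smoothGerms]
    exact congrArg Germ.ofFun (funext fun x => by simp)
  | add p q hp hq =>
    rw [map_add, AddMemClass.coe_add, hp, hq]
    exact congrArg Germ.ofFun (funext fun x => by simp)
  | mul_X p i hp =>
    rw [map_mul, MulMemClass.coe_mul, hp, polyGerm, aeval_X]
    exact congrArg Germ.ofFun (funext fun x => by simp)

/-- The maximal ideal of `𝓔ₙ`, generated by the coordinates. -/
noncomputable abbrev coordIdeal (n : ℕ) : Ideal (smoothGerms n) :=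
  (idealOfVars (Fin n) ℝ).map (polyGerm n)

theorem coordGerm_mem (i : Fin n) : (isSmoothGerm_coord i).germ ∈ coordIdeal n := by
  have : (isSmoothGerm_coord i).germ = polyGerm n (X i) := by rw [polyGerm, aeval_X]
  rw [this]
  exact Ideal.mem_map_of_mem _ (Ideal.subset_span ⟨i, rfl⟩)

theorem coordIdeal_le {I : Ideal (smoothGerms n)} (h : ∀ i, (isSmoothGerm_coord i).germ ∈ I) :
    coordIdeal n ≤ I := by
  rw [Ideal.map_le_iff_le_comap, Ideal.span_le]
  rintro _ ⟨i, rfl⟩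
  rw [SetLike.mem_coe, Ideal.mem_comap, polyGerm, aeval_X]
  exact h i

theorem exists_sub_algebraMap_mem_coordIdeal (a : smoothGerms n) :
    ∃ c : ℝ, a - algebraMap ℝ _ c ∈ coordIdeal n := by
  obtain ⟨f, hf, rfl⟩ := smoothGerms_exists_rep a
  have hc : IsSmoothGerm fun _ : RSpace n => f 0 := Eventually.of_forall fun _ => contDiffAt_const
  obtain ⟨g, hg, hfg⟩ := (hf.sub hc).exists_eq_sum_mul (by simp)
  refine ⟨f 0, ?_⟩
  have heq : hf.germ - algebraMap ℝ _ (f 0) = ∑ i, (hg i).germ * (isSmoothGerm_coord i).germ := by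
    apply Subtype.ext
    rw [AddSubgroupClass.coe_sub, algebraMap_smoothGerms, AddSubmonoidClass.coe_finsetSum]
    have h1 : ∀ i, (((hg i).germ * (isSmoothGerm_coord i).germ : smoothGerms n) :
        Germ (𝓝 (0 : RSpace n)) ℝ) =
        Germ.coeRingHom (𝓝 (0 : RSpace n)) (fun x => g i x * x i) := fun i => rfl
    simp_rw [h1]
    rw [← map_sum]
    refine Germ.coe_eq.mpr (hfg.trans (Eventually.of_forall fun x => ?_))
    simp [mul_comm]
  rw [heq]
  exact Submodule.sum_mem _ fun i _ => Ideal.mul_mem_left _ _ (coordGerm_mem i)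

/-- The ideal of smooth germs that are `O(‖x‖ ^ k)`. -/
noncomputable def orderIdeal (n k : ℕ) : Ideal (smoothGerms n) where
  carrier := {a | ∃ f : RSpace n → ℝ, (a : Germ (𝓝 (0 : RSpace n)) ℝ) = f ∧
    f =O[𝓝 0] fun x => ‖x‖ ^ k}
  zero_mem' := ⟨0, rfl, isBigO_zero _ _⟩
  add_mem' := by
    rintro a b ⟨f, hf, hf'⟩ ⟨g, hg, hg'⟩
    exact ⟨f + g, by rw [AddMemClass.coe_add, hf, hg]; rfl, hf'.add hg'⟩
  smul_mem' := by
    rintro c a ⟨f, hf, hf'⟩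
    obtain ⟨g, hg, rfl⟩ := smoothGerms_exists_rep c
    refine ⟨g * f, by rw [smul_eq_mul, MulMemClass.coe_mul, hf]; rfl, ?_⟩
    have hg1 : g =O[𝓝 0] fun _ => (1 : ℝ) := hg.continuousAt.isBigO_one ℝ
    simpa using! hg1.mul hf'

theorem IsSmoothGerm.germ_mem_orderIdeal {f : RSpace n → ℝ} (hf : IsSmoothGerm f) {k : ℕ} :
    hf.germ ∈ orderIdeal n k ↔ f =O[𝓝 0] fun x => ‖x‖ ^ k := by
  constructor
  · rintro ⟨g, hg, hg'⟩
    exact (Germ.coe_eq.mp hg).trans_isBigO hg'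
  · exact fun h => ⟨f, rfl, h⟩

theorem coordIdeal_pow_le_orderIdeal (k : ℕ) : coordIdeal n ^ k ≤ orderIdeal n k := by
  have h1 : coordIdeal n ≤ orderIdeal n 1 := by
    refine coordIdeal_le fun i => (isSmoothGerm_coord i).germ_mem_orderIdeal.mpr ?_
    refine IsBigO.of_bound 1 (Eventually.of_forall fun x => ?_)
    simpa using PiLp.norm_apply_le x i
  induction k with
  | zero =>
    intro a _
    obtain ⟨f, hf, rfl⟩ := smoothGerms_exists_rep a
    rw [hf.germ_mem_orderIdeal]
    simpa using hf.continuousAt.isBigO_one ℝ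
  | succ k ih =>
    rw [pow_succ, Ideal.mul_le]
    intro a ha b hb
    obtain ⟨f, hf, hf'⟩ := ih ha
    obtain ⟨g, hg, hg'⟩ := h1 hb
    refine ⟨f * g, by rw [MulMemClass.coe_mul, hf, hg]; rfl, ?_⟩
    simpa [pow_succ] using! hf'.mul hg'

theorem IsSmoothGerm.isBigO_of_germ_mem {f : RSpace n → ℝ} (hf : IsSmoothGerm f) {k : ℕ}
    (h : hf.germ ∈ coordIdeal n ^ k) : f =O[𝓝 0] fun x => ‖x‖ ^ k :=
  hf.germ_mem_orderIdeal.mp (coordIdeal_pow_le_orderIdeal k h)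

/-- A germ vanishing at `0` becomes a unit after adding `1`, with the pointwise reciprocal as smooth
inverse. -/
theorem coordIdeal_le_jacobson : coordIdeal n ≤ Ideal.jacobson ⊥ := by
  intro a ha
  rw [Ideal.mem_jacobson_bot]
  intro b
  obtain ⟨f, hf, hfb⟩ := smoothGerms_exists_rep (a * b)
  have hmem : hf.germ ∈ coordIdeal n ^ 1 := by
    rw [← hfb, pow_one]
    exact Ideal.mul_mem_right _ _ ha
  have hf0 : f 0 = 0 := by
    have := (hf.isBigO_of_germ_mem hmem).eq_zero_imp.self_of_nhds
    exact this (by simp)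
  have hne : ∀ᶠ x in 𝓝 (0 : RSpace n), f x + 1 ≠ 0 := by
    have hc : ContinuousAt (fun x => f x + 1) 0 := hf.continuousAt.add continuousAt_const
    exact hc.eventually_ne (by simp [hf0])
  have hinv : IsSmoothGerm fun x => (f x + 1)⁻¹ := by
    filter_upwards [hf, hne] with x hx hx'
    exact (hx.add contDiffAt_const).inv hx'
  rw [hfb]
  refine IsUnit.of_mul_eq_one hinv.germ (Subtype.ext ?_)
  refine Germ.coe_eq.mpr ?_
  filter_upwards [hne] with x hx
  exact mul_inv_cancel₀ hx

end GermAlgebra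

/-! ### Analytic order of decay versus powers of the maximal ideal -/

section Order

variable {n : ℕ}

open MvPolynomial

theorem isLittleO_norm_rpow {α β : ℝ} (hα : 0 ≤ α) (h : α < β) :
    (fun x : RSpace n => ‖x‖ ^ β) =o[𝓝 0] fun x => ‖x‖ ^ α := by
  have h1 : Tendsto (fun x : RSpace n => ‖x‖ ^ (β - α)) (𝓝 0) (𝓝 0) := by
    have : ContinuousAt (fun x : RSpace n => ‖x‖ ^ (β - α)) 0 :=
      continuous_norm.continuousAt.rpow_const (Or.inr (by linarith))
    have h0 : ‖(0 : RSpace n)‖ ^ (β - α) = 0 := by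
      rw [norm_zero, Real.zero_rpow (by linarith)]
    rwa [ContinuousAt, h0] at this
  have h2 := ((isLittleO_one_iff ℝ).mpr h1).mul_isBigO
    (isBigO_refl (fun x : RSpace n => ‖x‖ ^ α) (𝓝 0))
  refine h2.congr (fun x => ?_) (fun x => one_mul _)
  rcases (norm_nonneg x).eq_or_lt with h0 | h0
  · rw [← h0, Real.zero_rpow (x := β - α) (by linarith), Real.zero_rpow (x := β) (by linarith),
      zero_mul]
  · rw [← Real.rpow_add h0, sub_add_cancel]

theorem isLittleO_norm_pow_succ (k : ℕ) :
    (fun x : RSpace n => ‖x‖ ^ (k + 1)) =o[𝓝 0] fun x => ‖x‖ ^ k := by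
  have := isLittleO_norm_rpow (n := n) (α := k) (β := (k + 1 : ℕ)) (by positivity)
    (by push_cast; linarith)
  simpa only [Real.rpow_natCast] using this

/-- A positively homogeneous function of degree `α` that is `o(‖x‖ ^ α)` vanishes. -/
theorem eq_zero_of_homogeneous_of_isLittleO {h : RSpace n → ℝ} {α : ℝ}
    (hh : ∀ t : ℝ, 0 < t → ∀ x, h (t • x) = t ^ α * h x)
    (ho : h =o[𝓝 0] fun x => ‖x‖ ^ α) (x : RSpace n) : h x = 0 := by
  have hle : ∀ c : ℝ, 0 < c → ‖h x‖ ≤ c * ‖x‖ ^ α := by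
    intro c hc
    have hev := ho.def hc
    have ht : Tendsto (fun t : ℝ => t • x) (𝓝[>] 0) (𝓝 0) := by
      have : Continuous fun t : ℝ => t • x := continuous_id.smul continuous_const
      simpa using (this.tendsto 0).mono_left nhdsWithin_le_nhds
    obtain ⟨t, ht1, ht2⟩ := ((ht.eventually hev).and self_mem_nhdsWithin).exists
    have ht0 : 0 < t := ht2
    have hpos : 0 < t ^ α := Real.rpow_pos_of_pos ht0 α
    rw [hh t ht0, norm_mul, norm_smul, Real.norm_of_nonneg hpos.le, Real.norm_of_nonneg ht0.le,
      Real.mul_rpow ht0.le (norm_nonneg x),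
      Real.norm_of_nonneg (mul_nonneg hpos.le (Real.rpow_nonneg (norm_nonneg x) α))] at ht1
    have h3 : t ^ α * ‖h x‖ ≤ t ^ α * (c * ‖x‖ ^ α) := by linarith
    exact le_of_mul_le_mul_left h3 hpos
  have hlim : Tendsto (fun c : ℝ => c * ‖x‖ ^ α) (𝓝[>] 0) (𝓝 0) := by
    have : Continuous fun c : ℝ => c * ‖x‖ ^ α := continuous_id.mul continuous_const
    simpa using (this.tendsto 0).mono_left nhdsWithin_le_nhds
  have h0 : ‖h x‖ ≤ 0 := ge_of_tendsto hlim (by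
    filter_upwards [self_mem_nhdsWithin] with c hc using hle c hc)
  exact norm_le_zero_iff.mp h0

theorem MvPolynomial.IsHomogeneous.eval_smul_rpow {q : MvPolynomial (Fin n) ℝ} {d : ℕ}
    (hq : q.IsHomogeneous d) {t : ℝ} (x : RSpace n) :
    eval (fun i => (t • x) i) q = t ^ (d : ℝ) * eval (fun i => x i) q := by
  rw [Real.rpow_natCast]
  rw [eval_eq, eval_eq, Finset.mul_sum]
  refine Finset.sum_congr rfl fun a ha => ?_
  have hd : ∑ i ∈ a.support, a i = d := by
    rw [← Finsupp.degree_apply, Finsupp.degree_eq_weight_one]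
    exact hq (mem_support_iff.mp ha)
  simp_rw [PiLp.smul_apply, smul_eq_mul, mul_pow, Finset.prod_mul_distrib,
    Finset.prod_pow_eq_pow_sum]
  rw [hd]
  ring

/-- A polynomial that is `o(‖x‖ ^ k)` at the origin has order at least `k + 1`. -/
theorem mem_pow_idealOfVars_of_isLittleO {q : MvPolynomial (Fin n) ℝ} {k : ℕ}
    (hq : (fun x : RSpace n => eval (fun i => x i) q) =o[𝓝 0] fun x => ‖x‖ ^ k) :
    q ∈ idealOfVars (Fin n) ℝ ^ (k + 1) := by
  suffices H : ∀ j ≤ k + 1, q ∈ idealOfVars (Fin n) ℝ ^ j from H _ le_rfl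
  intro j
  induction j with
  | zero => simp
  | succ j ih =>
    intro hj
    have hqj := ih (by omega)
    have hlow : homogeneousComponent j q = lowDegreePart (j + 1) q := by
      have h := lowDegreePart_eq_zero hqj
      rw [lowDegreePart, Finset.sum_range_succ, ← lowDegreePart, LinearMap.add_apply, h, zero_add]
    have hsub : q - homogeneousComponent j q ∈ idealOfVars (Fin n) ℝ ^ (j + 1) := by
      rw [hlow]
      exact sub_lowDegreePart_mem (j + 1) q
    have hO : (fun x : RSpace n => eval (fun i => x i) (q - homogeneousComponent j q)) =o[𝓝 0]
        fun x => ‖x‖ ^ j := by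
      refine IsBigO.trans_isLittleO ?_ (isLittleO_norm_pow_succ j)
      apply (isSmoothGerm_eval _).isBigO_of_germ_mem
      rw [← polyGerm_eq, ← Ideal.map_pow]
      exact Ideal.mem_map_of_mem _ hsub
    have hqo : (fun x : RSpace n => eval (fun i => x i) q) =o[𝓝 0] fun x => ‖x‖ ^ j := by
      rcases (show j = k ∨ j < k by omega) with rfl | hlt
      · exact hq
      · have := isLittleO_norm_rpow (n := n) (α := j) (β := k) (by positivity)
          (by exact_mod_cast hlt)
        simp only [Real.rpow_natCast] at this
        exact hq.trans this
    -- The component of degree `j` is a difference of two functions that are `o(‖x‖ ^ j)`; being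
    -- homogeneous of degree `j`, it vanishes.
    have hcomp := hqo.sub hO
    have hzero : ∀ x : RSpace n, eval (fun i => x i) (homogeneousComponent j q) = 0 := by
      refine eq_zero_of_homogeneous_of_isLittleO (α := j) ?_ ?_
      · intro t _ x
        exact (homogeneousComponent_isHomogeneous j q).eval_smul_rpow x
      · simpa using hcomp
    have : homogeneousComponent j q = 0 := by
      apply MvPolynomial.funext
      intro x
      simpa using hzero (WithLp.toLp 2 x)
    rwa [this, sub_zero] at hsub

theorem mem_pow_of_polyGerm_mem (q : MvPolynomial (Fin n) ℝ) (k : ℕ)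
    (h : polyGerm n q ∈ coordIdeal n ^ k) : q ∈ idealOfVars (Fin n) ℝ ^ k := by
  cases k with
  | zero => simp
  | succ k =>
    rw [polyGerm_eq] at h
    exact mem_pow_idealOfVars_of_isLittleO
      (((isSmoothGerm_eval q).isBigO_of_germ_mem h).trans_isLittleO (isLittleO_norm_pow_succ k))

/-- The Taylor polynomial of `f` inherits the decay of `f`, so it has order at least `k + 1`, as
does the remainder. -/
theorem IsSmoothGerm.germ_mem_pow_of_isLittleO {f : RSpace n → ℝ} (hf : IsSmoothGerm f) {k : ℕ}
    (ho : f =o[𝓝 0] fun x => ‖x‖ ^ k) : hf.germ ∈ coordIdeal n ^ (k + 1) := by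
  obtain ⟨q, hq⟩ :=
    exists_sub_mem_pow (ι := polyGerm n) exists_sub_algebraMap_mem_coordIdeal (k + 1) hf.germ
  have hO : (f - fun x : RSpace n => eval (fun i => x i) q) =o[𝓝 0] fun x => ‖x‖ ^ k := by
    refine IsBigO.trans_isLittleO ?_ (isLittleO_norm_pow_succ k)
    apply (hf.sub (isSmoothGerm_eval q)).isBigO_of_germ_mem
    rw [polyGerm_eq] at hq
    exact hq
  have hq' : q ∈ idealOfVars (Fin n) ℝ ^ (k + 1) := by
    apply mem_pow_idealOfVars_of_isLittleO
    simpa using ho.sub hO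
  have hq'' : polyGerm n q ∈ coordIdeal n ^ (k + 1) := by
    rw [← Ideal.map_pow]
    exact Ideal.mem_map_of_mem _ hq'
  simpa using add_mem hq hq''

end Order

/-! ### Partial derivatives on germs -/

section Derivation

variable {n : ℕ}

open MvPolynomial

theorem partialD_congr {f g : RSpace n → ℝ} (h : f =ᶠ[𝓝 0] g) (i : Fin n) :
    partialD i f =ᶠ[𝓝 0] partialD i g := by
  filter_upwards [h.fderiv (𝕜 := ℝ)] with x hx
  simp [partialD, hx]

/-- The partial derivative on germs. -/
noncomputable def germD (i : Fin n) (a : smoothGerms n) : smoothGerms n :=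
  ((smoothGerms_exists_rep a).choose_spec.choose.partialD i).germ

theorem germD_germ (i : Fin n) {f : RSpace n → ℝ} (hf : IsSmoothGerm f) :
    germD i hf.germ = (hf.partialD i).germ := by
  have h := (smoothGerms_exists_rep hf.germ).choose_spec.choose_spec
  exact (IsSmoothGerm.germ_eq_iff _ _).mpr
    (partialD_congr ((IsSmoothGerm.germ_eq_iff _ _).mp h.symm) i)

theorem IsSmoothGerm.eventually_differentiableAt {f : RSpace n → ℝ} (hf : IsSmoothGerm f) :
    ∀ᶠ x in 𝓝 0, DifferentiableAt ℝ f x := by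
  filter_upwards [hf] with x hx using hx.differentiableAt (by simp)

theorem germD_add (i : Fin n) (a b : smoothGerms n) : germD i (a + b) = germD i a + germD i b := by
  obtain ⟨f, hf, rfl⟩ := smoothGerms_exists_rep a
  obtain ⟨g, hg, rfl⟩ := smoothGerms_exists_rep b
  have hfg : IsSmoothGerm (f + g) := by
    filter_upwards [hf, hg] with x h₁ h₂ using h₁.add h₂
  have h1 : hf.germ + hg.germ = hfg.germ := rfl
  rw [h1, germD_germ, germD_germ, germD_germ]
  refine Subtype.ext (Germ.coe_eq.mpr ?_)
  filter_upwards [hf.eventually_differentiableAt, hg.eventually_differentiableAt] with x h₁ h₂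
  simp [partialD, fderiv_add h₁ h₂]

theorem germD_mul (i : Fin n) (a b : smoothGerms n) :
    germD i (a * b) = a * germD i b + b * germD i a := by
  obtain ⟨f, hf, rfl⟩ := smoothGerms_exists_rep a
  obtain ⟨g, hg, rfl⟩ := smoothGerms_exists_rep b
  have hfg : IsSmoothGerm (f * g) := by
    filter_upwards [hf, hg] with x h₁ h₂ using h₁.mul h₂
  have h1 : hf.germ * hg.germ = hfg.germ := rfl
  rw [h1, germD_germ, germD_germ, germD_germ]
  refine Subtype.ext (Germ.coe_eq.mpr ?_)
  filter_upwards [hf.eventually_differentiableAt, hg.eventually_differentiableAt] with x h₁ h₂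
  simp [partialD, fderiv_mul h₁ h₂]

/-- By the Leibniz rule, differentiation lowers order by at most one. -/
theorem germD_mem_pow (i : Fin n) {k : ℕ} {a : smoothGerms n} (ha : a ∈ coordIdeal n ^ (k + 1)) :
    germD i a ∈ coordIdeal n ^ k := by
  induction k generalizing a with
  | zero => simp
  | succ k ih =>
    rw [pow_succ'] at ha
    induction ha using Submodule.mul_induction_on' with
    | mem_mul_mem x hx y hy =>
      rw [germD_mul]
      refine add_mem ?_ (Ideal.mul_mem_right _ _ hy)
      rw [pow_succ']
      exact Ideal.mul_mem_mul hx (ih hy)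
    | add x _ y _ hx hy =>
      rw [germD_add]
      exact add_mem hx hy

theorem germD_polyGerm (i : Fin n) (q : MvPolynomial (Fin n) ℝ) :
    germD i (polyGerm n q) = polyGerm n (pderiv i q) := by
  induction q using MvPolynomial.induction_on with
  | C a =>
    rw [pderiv_C, map_zero, polyGerm_eq, germD_germ]
    refine Subtype.ext (Germ.coe_eq.mpr (Eventually.of_forall fun x => ?_))
    simp [partialD]
  | add p q hp hq => simp [germD_add, hp, hq]
  | mul_X p j hp =>
    have hX : germD i (polyGerm n (X j)) = polyGerm n (pderiv i (X j)) := by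
      rw [polyGerm, aeval_X, germD_germ, ← polyGerm, polyGerm_eq]
      refine Subtype.ext (Germ.coe_eq.mpr (Eventually.of_forall fun x => ?_))
      have h1 : fderiv ℝ (fun x : RSpace n => x j) x = EuclideanSpace.proj (𝕜 := ℝ) j :=
        (EuclideanSpace.proj (𝕜 := ℝ) j).fderiv
      simp [partialD, h1, pderiv_X, Pi.single_apply]
    rw [map_mul, germD_mul, hp, hX, Derivation.leibniz, map_add, smul_eq_mul, smul_eq_mul,
      map_mul, map_mul]

end Derivation

/-! ### Initial parts are forms, and their degree is a Lipschitz invariant -/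

section InitialPart

variable {n : ℕ}

open MvPolynomial

/-- A bound on a sphere inside the domain of smoothness, obtained by compactness, spreads to all
points by scaling. -/
theorem isBigO_of_homogeneous {h : RSpace n → ℝ} (hs : IsSmoothGerm h) {α : ℝ} (hα : 0 < α)
    (hh : ∀ t : ℝ, 0 < t → ∀ x, h (t • x) = t ^ α * h x) :
    h =O[𝓝 0] fun x => ‖x‖ ^ α := by
  obtain ⟨r, hr, hball⟩ := Metric.eventually_nhds_iff_ball.mp hs
  have hr2 : 0 < r / 2 := by positivity
  have hcont : ContinuousOn h (Metric.sphere 0 (r / 2)) := by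
    intro x hx
    refine (hball x ?_).continuousAt.continuousWithinAt
    rw [Metric.mem_ball, Metric.mem_sphere.mp hx]
    linarith
  obtain ⟨C, hC⟩ := (isCompact_sphere (0 : RSpace n) (r / 2)).exists_bound_of_continuousOn hcont
  refine IsBigO.of_bound (C / (r / 2) ^ α) (Eventually.of_forall fun x => ?_)
  rcases eq_or_ne x 0 with rfl | hx
  · have h2 := hh 2 (by norm_num) 0
    have h3 : (1 : ℝ) < 2 ^ α := Real.one_lt_rpow (by norm_num) hα
    rw [smul_zero] at h2
    have h4 : h 0 = 0 := by
      have : (2 ^ α - 1) * h 0 = 0 := by linarith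
      rcases mul_eq_zero.mp this with h5 | h5
      · linarith
      · exact h5
    simp [h4, Real.zero_rpow hα.ne']
  · have hxn : 0 < ‖x‖ := norm_pos_iff.mpr hx
    have ht : 0 < ‖x‖ / (r / 2) := by positivity
    have hxy : x = (‖x‖ / (r / 2)) • ((r / 2 / ‖x‖) • x) := by
      rw [smul_smul]
      have : ‖x‖ / (r / 2) * (r / 2 / ‖x‖) = 1 := by field_simp
      rw [this, one_smul]
    have hy : (r / 2 / ‖x‖) • x ∈ Metric.sphere (0 : RSpace n) (r / 2) := by
      rw [mem_sphere_zero_iff_norm, norm_smul, Real.norm_of_nonneg (by positivity)]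
      field_simp
    have hpos : 0 ≤ (‖x‖ / (r / 2)) ^ α := Real.rpow_nonneg ht.le α
    calc ‖h x‖ = ‖(‖x‖ / (r / 2)) ^ α * h ((r / 2 / ‖x‖) • x)‖ := by
          rw [← hh _ ht, ← hxy]
      _ ≤ (‖x‖ / (r / 2)) ^ α * C := by
          rw [norm_mul, Real.norm_of_nonneg hpos]
          exact mul_le_mul_of_nonneg_left (hC _ hy) hpos
      _ = C / (r / 2) ^ α * ‖‖x‖ ^ α‖ := by
          rw [Real.div_rpow hxn.le hr2.le, Real.norm_of_nonneg (Real.rpow_nonneg hxn.le α)]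
          ring

/-- A smooth positively homogeneous function of positive degree `α` that is not `o(‖x‖ ^ α)` is a
form of degree `α`. -/
theorem exists_eq_eval_of_homogeneous {h : RSpace n → ℝ} (hs : IsSmoothGerm h) {α : ℝ} (hα : 0 < α)
    (hh : ∀ t : ℝ, 0 < t → ∀ x, h (t • x) = t ^ α * h x)
    (hno : ¬ (h =o[𝓝 0] fun x => ‖x‖ ^ α)) :
    ∃ (d : ℕ) (Q : MvPolynomial (Fin n) ℝ), α = (d + 1 : ℕ) ∧ Q.IsHomogeneous (d + 1) ∧
      h = fun x => eval (fun i => x i) Q := by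
  have hO := isBigO_of_homogeneous hs hα hh
  -- With `d < α ≤ d + 1`, `h` is `o(‖x‖ ^ d)` and hence `O(‖x‖ ^ (d + 1))` by smoothness; `α < d +
  -- 1` would then contradict `hno`.
  obtain ⟨d, hd⟩ : ∃ d, ⌈α⌉₊ = d + 1 := Nat.exists_eq_succ_of_ne_zero (Nat.ceil_pos.mpr hα).ne'
  have hlt : (d : ℝ) < α := Nat.lt_ceil.mp (by omega)
  have ho : h =o[𝓝 0] fun x => ‖x‖ ^ d := by
    simpa only [Real.rpow_natCast] using
      hO.trans_isLittleO (isLittleO_norm_rpow (n := n) (Nat.cast_nonneg d) hlt)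
  have hmem := hs.germ_mem_pow_of_isLittleO ho
  have hle : α ≤ (d + 1 : ℕ) := hd ▸ Nat.le_ceil α
  have heq : α = (d + 1 : ℕ) := by
    refine le_antisymm hle (not_lt.mp fun hlt' => hno ?_)
    have h1 := hs.isBigO_of_germ_mem hmem
    have h2 := isLittleO_norm_rpow (n := n) hα.le hlt'
    simp only [Real.rpow_natCast] at h2
    exact h1.trans_isLittleO h2
  obtain ⟨q, hq, hqh⟩ := exists_mem_pow_sub_mem_pow_succ (ι := polyGerm n)
    exists_sub_algebraMap_mem_coordIdeal hmem
  have hlow : homogeneousComponent (d + 1) q = lowDegreePart (d + 1 + 1) q := by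
    have h := lowDegreePart_eq_zero hq
    rw [lowDegreePart, Finset.sum_range_succ, ← lowDegreePart, LinearMap.add_apply, h, zero_add]
  set Q := homogeneousComponent (d + 1) q with hQ
  have hQhom : Q.IsHomogeneous (d + 1) := homogeneousComponent_isHomogeneous _ _
  refine ⟨d, Q, heq, hQhom, ?_⟩
  have hgerm : (hs.sub (isSmoothGerm_eval Q)).germ ∈ coordIdeal n ^ (d + 1 + 1) := by
    have h1 : polyGerm n (q - Q) ∈ coordIdeal n ^ (d + 1 + 1) := by
      rw [← Ideal.map_pow]
      refine Ideal.mem_map_of_mem _ ?_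
      rw [hlow]
      exact sub_lowDegreePart_mem _ q
    have h2 : (hs.sub (isSmoothGerm_eval Q)).germ =
        hs.germ - polyGerm n q + polyGerm n (q - Q) := by
      rw [map_sub, sub_add_sub_cancel, polyGerm_eq]
      rfl
    rw [h2]
    exact add_mem hqh h1
  have hlo : (h - fun x : RSpace n => eval (fun i => x i) Q) =o[𝓝 0] fun x => ‖x‖ ^ α := by
    have h1 := ((hs.sub (isSmoothGerm_eval Q)).isBigO_of_germ_mem hgerm).trans_isLittleO
      (isLittleO_norm_pow_succ (d + 1))
    rw [heq]
    simpa only [Real.rpow_natCast] using h1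
  funext x
  refine sub_eq_zero.mp (eq_zero_of_homogeneous_of_isLittleO (α := α) ?_ hlo x)
  intro t ht x
  simp only [Pi.sub_apply]
  rw [hh t ht, hQhom.eval_smul_rpow, heq]
  ring

/-- The degree of an initial part is positive for functions vanishing at the origin. -/
theorem pos_of_isInitialPart {f h : RSpace n → ℝ} (hf0 : f 0 = 0) (hs : ContinuousAt h 0) {α : ℝ}
    (hα : 0 ≤ α) (hno : ¬ (h =o[𝓝 0] fun x => ‖x‖ ^ α))
    (ho : (fun x => f x - h x) =o[𝓝 0] fun x => ‖x‖ ^ α) : 0 < α := by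
  refine lt_of_le_of_ne hα fun h0 => hno ?_
  subst h0
  simp only [Real.rpow_zero] at ho ⊢
  rw [isLittleO_one_iff] at ho ⊢
  -- The neighbourhood filter is not punctured, so the limit must agree with the value at `0`.
  have h1 : f 0 - h 0 = 0 :=
    tendsto_nhds_unique (tendsto_pure_nhds _ _) (ho.mono_left (pure_le_nhds 0))
  have h2 : h 0 = 0 := by linarith
  rw [← h2]
  exact hs

theorem RAsympLipEquiv.symm {f g : RSpace n → ℝ} (h : RAsympLipEquiv f g) : RAsympLipEquiv g f := by
  obtain ⟨φ, U, V, hU, hV, h0, hφ0, ⟨hbij, c, hc, hlip⟩, c₁, c₂, hc₁, hc₂, hev⟩ := h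
  have hinv := hbij.invOn_invFunOn
  set ψ := Function.invFunOn φ U with hψ
  have hψV : Set.BijOn ψ V U := hbij.symm hinv.symm
  have h0V : (0 : RSpace n) ∈ V := hφ0 ▸ hbij.mapsTo h0
  have hψ0 : ψ 0 = 0 := by
    have := hinv.1 h0
    rwa [hφ0] at this
  have hlip' : ∀ x ∈ V, ∀ y ∈ V, 1 / c * ‖x - y‖ ≤ ‖ψ x - ψ y‖ ∧ ‖ψ x - ψ y‖ ≤ c * ‖x - y‖ := by
    intro x hx y hy
    have h1 := hlip (ψ x) (hψV.mapsTo hx) (ψ y) (hψV.mapsTo hy)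
    rw [hinv.2 hx, hinv.2 hy] at h1
    constructor
    · rw [one_div, inv_mul_le_iff₀ hc]
      exact h1.2
    · rw [one_div, inv_mul_le_iff₀ hc] at h1
      exact h1.1
  have htend : Tendsto ψ (𝓝 0) (𝓝 0) := by
    have hz : Tendsto (fun x : RSpace n => c * ‖x‖) (𝓝 0) (𝓝 0) := by
      have : Continuous fun x : RSpace n => c * ‖x‖ := continuous_const.mul continuous_norm
      simpa using this.tendsto 0
    refine squeeze_zero_norm' ?_ hz
    filter_upwards [hV.mem_nhds h0V] with x hx
    simpa [hψ0] using (hlip' x hx 0 h0V).2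
  refine ⟨ψ, V, U, hV, hU, h0V, hψ0, ⟨hψV, c, hc, hlip'⟩, c₂⁻¹, c₁⁻¹, inv_pos.mpr hc₂,
    inv_pos.mpr hc₁, ?_⟩
  filter_upwards [htend.eventually hev, hV.mem_nhds h0V] with y hy hyV
  simp only [Function.comp_apply, hinv.2 hyV] at hy ⊢
  constructor
  · rw [inv_mul_le_iff₀ hc₁]
    exact hy.2
  · rw [← div_eq_inv_mul, le_div_iff₀ hc₂, mul_comm]
    exact hy.1

/-- If `α < β`, then `f` is bounded by a multiple of `‖φ x‖ ^ β`, hence of `‖x‖ ^ β`, which is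
`o(‖x‖ ^ α)`; so `f₀` would be `o(‖x‖ ^ α)` too. -/
theorem le_of_rAsympLipEquiv {f g f₀ g₀ : RSpace n → ℝ} (hfg : RAsympLipEquiv f g) {α β : ℝ}
    (hα : 0 ≤ α) (hβ : 0 ≤ β) (hno : ¬ (f₀ =o[𝓝 0] fun x => ‖x‖ ^ α))
    (hof : (fun x => f x - f₀ x) =o[𝓝 0] fun x => ‖x‖ ^ α)
    (hg₀ : g₀ =O[𝓝 0] fun x => ‖x‖ ^ β)
    (hog : (fun x => g x - g₀ x) =o[𝓝 0] fun x => ‖x‖ ^ β) : β ≤ α := by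
  refine not_lt.mp fun hlt => hno ?_
  obtain ⟨φ, U, V, hU, hV, h0, hφ0, ⟨hbij, c, hc, hlip⟩, c₁, c₂, hc₁, hc₂, hev⟩ := hfg
  have hg : g =O[𝓝 0] fun x => ‖x‖ ^ β := by
    simpa using hog.isBigO.add hg₀
  have hφ : ∀ x ∈ U, ‖φ x‖ ≤ c * ‖x‖ := by
    intro x hx
    simpa [hφ0] using (hlip x hx 0 h0).2
  have htend : Tendsto φ (𝓝 0) (𝓝 0) := by
    have hz : Tendsto (fun x : RSpace n => c * ‖x‖) (𝓝 0) (𝓝 0) := by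
      have : Continuous fun x : RSpace n => c * ‖x‖ := continuous_const.mul continuous_norm
      simpa using this.tendsto 0
    refine squeeze_zero_norm' ?_ hz
    filter_upwards [hU.mem_nhds h0] with x hx using hφ x hx
  have h1 : f =O[𝓝 0] (g ∘ φ) := by
    refine IsBigO.of_bound c₂⁻¹ ?_
    filter_upwards [hev] with x hx
    rw [← div_eq_inv_mul, le_div_iff₀ hc₂, mul_comm]
    exact hx.1
  have h2 : (g ∘ φ) =O[𝓝 0] fun x => ‖φ x‖ ^ β := hg.comp_tendsto htend
  have h3 : (fun x => ‖φ x‖ ^ β) =O[𝓝 0] fun x : RSpace n => ‖x‖ ^ β := by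
    refine IsBigO.of_bound (c ^ β) ?_
    filter_upwards [hU.mem_nhds h0] with x hx
    rw [Real.norm_of_nonneg (Real.rpow_nonneg (norm_nonneg _) _),
      Real.norm_of_nonneg (Real.rpow_nonneg (norm_nonneg _) _),
      ← Real.mul_rpow hc.le (norm_nonneg _)]
    exact Real.rpow_le_rpow (norm_nonneg _) (hφ x hx) hβ
  have h4 := ((h1.trans h2).trans h3).trans_isLittleO (isLittleO_norm_rpow (n := n) hα hlt)
  simpa using h4.sub hof

end InitialPart

/-! ### The Milnor number as a function of the degree -/

section MilnorNumber

variable {n : ℕ}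

open MvPolynomial

theorem Module.finite_of_toENat_rank_lt_top {K V : Type*} [Field K] [AddCommGroup V] [Module K V]
    (h : Cardinal.toENat (Module.rank K V) < ⊤) : Module.Finite K V :=
  Module.rank_lt_aleph0_iff.mp (Cardinal.toENat_lt_top.mp h)

/-- If the initial form `Q` of `f` has degree `d + 1` and an algebraically isolated singularity, the
Milnor number of `f` only depends on `d` and the number of variables. -/
theorem milnorNumber_eq_truncatedDim {f : RSpace n → ℝ} (hf : IsSmoothGerm f)
    {Q : MvPolynomial (Fin n) ℝ} {d : ℕ} (hQ : Q.IsHomogeneous (d + 1))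
    (ho : (fun x => f x - eval (fun i => x i) Q) =o[𝓝 0] fun x : RSpace n => ‖x‖ ^ (d + 1))
    (hiso : AlgIsolatedSing fun x : RSpace n => eval (fun i => x i) Q) :
    ∃ N₀, ∀ N ≥ N₀, milnorNumber f hf = truncatedDim (Fin n) ℝ d n N := by
  obtain ⟨hQs, hfin⟩ := hiso
  have hpd : ∀ i, (hQs.partialD i).germ = polyGerm n (pderiv i Q) := by
    intro i
    rw [← germD_polyGerm, polyGerm_eq, germD_germ]
  have hfin' : Module.Finite ℝ
      (smoothGerms n ⧸ Ideal.span (Set.range fun i => polyGerm n (pderiv i Q))) := by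
    have h := Module.finite_of_toENat_rank_lt_top hfin
    rwa [jacobianIdeal, funext hpd] at h
  have hF : ∀ i, (hf.partialD i).germ - polyGerm n (pderiv i Q) ∈ coordIdeal n ^ (d + 1) := by
    intro i
    have hmem := (hf.sub (isSmoothGerm_eval Q)).germ_mem_pow_of_isLittleO ho
    have h2 : hf.germ = (hf.sub (isSmoothGerm_eval Q)).germ + polyGerm n Q := by
      rw [polyGerm_eq]
      exact (sub_add_cancel hf.germ (isSmoothGerm_eval Q).germ).symm
    rw [← germD_germ i hf, h2, germD_add, germD_polyGerm, add_sub_cancel_right]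
    exact germD_mem_pow i hmem
  obtain ⟨N₀, hN₀⟩ := rank_quotient_span_eq (ι := polyGerm n) coordIdeal_le_jacobson
    exists_sub_algebraMap_mem_coordIdeal mem_pow_of_polyGerm_mem
    (m := d) (fun i => hQ.pderiv) hF
  refine ⟨N₀, fun N hN => ?_⟩
  rw [milnorNumber, jacobianIdeal, hN₀ N hN]
  simp

end MilnorNumber

theorem theorem4p3 (n : ℕ) (f g : RSpace n → ℝ)
    (hf : IsSmoothGerm f) (hg : IsSmoothGerm g) (hf0 : f 0 = 0) (hg0 : g 0 = 0)
    (f₀ g₀ : RSpace n → ℝ)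
    (hf₀ : IsInitialPart f f₀) (hg₀ : IsInitialPart g g₀)
    (hf₁ : AlgIsolatedSing f₀) (hg₁ : AlgIsolatedSing g₀)
    (hfg : RAsympLipEquiv f g) :
    milnorNumber f hf = milnorNumber g hg := by
  obtain ⟨α, hα, hhf, hnf, hof⟩ := hf₀
  obtain ⟨β, hβ, hhg, hng, hog⟩ := hg₀
  obtain ⟨hfs, -⟩ := id hf₁
  obtain ⟨hgs, -⟩ := id hg₁
  have hα' := pos_of_isInitialPart hf0 hfs.continuousAt hα hnf hof
  have hβ' := pos_of_isInitialPart hg0 hgs.continuousAt hβ hng hog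
  have hαβ : α = β := le_antisymm
    (le_of_rAsympLipEquiv hfg.symm hβ hα hng hog (isBigO_of_homogeneous hfs hα' hhf) hof)
    (le_of_rAsympLipEquiv hfg hα hβ hnf hof (isBigO_of_homogeneous hgs hβ' hhg) hog)
  subst hαβ
  obtain ⟨d, P, hd, hP, rfl⟩ := exists_eq_eval_of_homogeneous hfs hα' hhf hnf
  obtain ⟨e, Q, he, hQ, rfl⟩ := exists_eq_eval_of_homogeneous hgs hβ' hhg hng
  obtain rfl : d = e := by
    have := hd.symm.trans he
    norm_cast at this
    omega
  subst hd
  simp only [Real.rpow_natCast] at hof hog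
  obtain ⟨N₁, hN₁⟩ := milnorNumber_eq_truncatedDim hf hP hof hf₁
  obtain ⟨N₂, hN₂⟩ := milnorNumber_eq_truncatedDim hg hQ hog hg₁
  -- Both numbers are read off at one common truncation level.
  rw [hN₁ _ (le_max_left N₁ N₂), hN₂ _ (le_max_right N₁ N₂)]
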